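/- **Setting.** Let $w:\mathbb N\to\mathbb R$ be an increasing function with $\frac{\log\log x}{\log\log\log x}<w(x)\le\log\log x$ for all sufficiently large $x$, and put $W(x)=\prod_{p\le w(x)}p$. For $g:\mathbb N\to\mathbb R$ write $S_g(x;Q,A)=\frac{Q}{x}\sum_{1\le n\le x,\ n\equiv A \,(\mathrm{mod}\, Q)}g(n)$. Let $N$ and $T$ be positive integer parameters with $N^{1-o(1)}\ll T\ll N$, and write $W=W(N)$. The letter $p$ denotes primes. **Lemma 3.1.** Let $E$ and $H$ be positive integers. Let $f:\mathbb N\to\mathbb R$ be a multiplicative function with $|f(p^k)|\le H^k$ at all prime powers $p^k$ ($k\ge1$). Then there are multiplicative functions $f_1,\dots,f_H:\mathbb N\to\mathbb R$, depending only on $f$ and $H$, with Dirichlet convolution $f=f_1*\dots*f_H$, with $f_i(p)=f(p)/H$ for all $i$ and all primes $p$, and with $f_i$ supported on squarefree integers for $i<H$, such that the following holds for all sufficiently large $N$ and all $T$ as above. Suppose that for all positive integers $q\le(\log N)^E$ and all $A'\in(\mathbb Z/Wq\mathbb Z)^*$ with $S_{|f|}(T;Wq,A')>0$ we have $$\sum_{\substack{p\le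 T\\ p\equiv A'\,(\mathrm{mod}\,Wq)}}|f(p)|\log p\ \gg\ \frac{T}{\phi(Wq)}$$ and $$S_{|f|}(T;Wq,A')\ \asymp\ \frac{Wq}{\phi(Wq)}\,\frac1{\log T}\exp\bigg(\sum_{\substack{p\le T\\ p\nmid Wq}}\frac{|f(p)|}{p}\bigg).$$ Then for all positive integers $q\le(\log N)^E$ and all $A'\in(\mathbb Z/Wq\mathbb Z)^*$ with $S_{|f|}(T;Wq,A')>0$ the averaged second-moment condition holds with $t=H$ and $\theta_f=\frac12$, that is, $$\sum_{i=1}^{H}\ \sum_{\substack{(d_j)_{j\ne i}\\ (D_i,W)=1\\ D_i\le T^{1-1/H}}}\bigg(\prod_{j\ne i}\frac{|f_j(d_j)|}{d_j}\bigg)\sqrt{\frac{D_iWq}{T}\sum_{\substack{n\le T/D_i\\ nD_i\equiv A'\,(\mathrm{mod}\,Wq)}}|f_i(n)|^2}\ \ll\ (\log T)^{1-\frac12}\,S_{|f|}(T;Wq,A'),$$ where $(d_j)_{j\ne i}$ runs over tuples of positive integers indexed by $j\in\{1,\dots,H\}\setminus\{i\}$, and $D_i=\prod_{j\ne i}d_j$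 (so $D_1=1$ if $H=1$). The implied constant in the conclusion, and the bound beyond which $N$ counts as sufficiently large, depend only on $E$, $H$, $w$, the rate $o(1)$ and implied constants in $N^{1-o(1)}\ll T\ll N$, and the implied constants in the two hypotheses; in particular they do not depend on $f$, $q$, $A'$. -/

import Mathlib

noncomputable section

/-- An admissible growth function `w : ℕ → ℝ`: it is increasing and satisfies
`log log x / log log log x < w x ≤ log log x` for all sufficiently large `x`. -/
structure IsAdmissibleGrowth (w : ℕ → ℝ) : Prop where
  mono : Monotone w
  lower : ∀ᶠ x : ℕ in Filter.atTop,
    Real.log (Real.log x) / Real.log (Real.log (Real.log x)) < w x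
  upper : ∀ᶠ x : ℕ in Filter.atTop, w x ≤ Real.log (Real.log x)

/-- `W(x) = ∏_{p ≤ w(x)} p`, the product over the primes `p ≤ w(x)`. -/
def primeProd (w : ℕ → ℝ) (x : ℕ) : ℕ := primorial ⌊w x⌋₊

/-- `S_g(x; Q, A) = (Q / x) ∑_{1 ≤ n ≤ x, n ≡ A mod Q} g(n)`. -/
def progMean (g : ℕ → ℝ) (x Q : ℕ) (A : ZMod Q) : ℝ :=
  (Q : ℝ) / x * ∑ n ∈ Finset.Icc 1 x with (Nat.cast n : ZMod Q) = A, g n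

/-- `∑_{p ≤ x, p ≡ A mod Q} |f(p)| log p`, the sum over primes `p`. -/
def primeLogSum (f : ArithmeticFunction ℝ) (x Q : ℕ) (A : ZMod Q) : ℝ :=
  ∑ p ∈ Finset.Icc 1 x with Nat.Prime p ∧ (Nat.cast p : ZMod Q) = A, |f p| * Real.log p

/-- The Shiu-type order of magnitude
`(Q / φ(Q)) (1 / log x) exp (∑_{p ≤ x, p ∤ Q} |f(p)| / p)`. -/
def shiuOrder (f : ArithmeticFunction ℝ) (x Q : ℕ) : ℝ :=
  (Q : ℝ) / (Nat.totient Q : ℝ) * (1 / Real.log x) *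
    Real.exp (∑ p ∈ Finset.Icc 1 x with p.Prime ∧ ¬ p ∣ Q, |f p| / p)

/-- The tuples `(d_j)_{j ≠ i}` of positive integers whose product `D_i` is coprime to `W` and
satisfies `D_i ≤ T ^ (1 - 1 / t)`. (The bound `d_j ≤ T` of the box follows from the bound
on the product, so it removes nothing.) -/
def cofactorTuples {t : ℕ} (i : Fin t) (T W : ℕ) : Finset ({j : Fin t // j ≠ i} → ℕ) :=
  (Fintype.piFinset fun _ => Finset.Icc 1 T).filter fun d =>
    (∏ j, d j).Coprime W ∧ ((∏ j, d j : ℕ) : ℝ) ≤ (T : ℝ) ^ (1 - 1 / (t : ℝ))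

/-- `(D Q / T) ∑_{n ≤ T / D, n D ≡ A mod Q} |g(n)|²`. -/
def progSecondMoment (g : ℕ → ℝ) (T D Q : ℕ) (A : ZMod Q) : ℝ :=
  (D : ℝ) * Q / T *
    ∑ n ∈ Finset.Icc 1 (T / D) with ((n * D : ℕ) : ZMod Q) = A, |g n| ^ 2

/-- The averaged second moment of a Dirichlet decomposition `F = (f_1, …, f_t)`:
`∑_i ∑_{(d_j)_{j ≠ i}} (∏_{j ≠ i} |f_j(d_j)| / d_j)
  √((D_i W q / T) ∑_{n ≤ T / D_i, n D_i ≡ A mod W q} |f_i(n)|²)`,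
over the tuples with `D_i = ∏_{j ≠ i} d_j` coprime to `W` and at most `T ^ (1 - 1 / t)`. -/
def avgSecondMoment {t : ℕ} (F : Fin t → ArithmeticFunction ℝ) (T W q : ℕ)
    (A : ZMod (W * q)) : ℝ :=
  ∑ i, ∑ d ∈ cofactorTuples i T W,
    (∏ j : {j : Fin t // j ≠ i}, |F j (d j)| / (d j : ℝ)) *
      Real.sqrt (progSecondMoment (F i) T (∏ j, d j) (W * q) A)

end

/-! Take `f_i`, for `i < H`, to be the squarefree-supported function with value `f(p)/H` at `p`. Its
Dirichlet inverse is completely multiplicative, so the last factor can be `f` convolved with `H - 1`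
such inverses: it again has value `f(p)/H` at primes, and all factors are at most `(2H)^k` at `p^k`.
Fix `i` and let `h` be the convolution of the `|f_j|`, `j ≠ i`. Write `Q = Wq`, `S` for the mean of
`|f|` over the progression, and `X = exp(∑ |f(p)|/p)` over `p ≤ T`, `p ∤ Q`. Cauchy–Schwarz over the
tuples (`sum_cofactorTuples_le_sqrt_mul_sqrt`) bounds the `i`-th summand by the square root of `∑
h(D)/D`, over `D ≤ T` coprime to `Q`, times the square root of the mean of `f_i² * h` over the
progression. At a prime, `h` is `(H-1)|f(p)|/H` and `f_i² * h` is `(|f(p)|/H)² + (H-1)|f(p)|/H`;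
both are at most `|f(p)|` because `|f(p)| ≤ H`. Hence both functions are majorised by `sqf |f| *
powerful B` with `B = 6H²`. The first sum is then `≪ X`, and `X ≪ S log T` by the lower Shiu-type
hypothesis. It remains to show that the mean of the majorant is `≪ S`, which gives `√(S log T) √S =
√(log T) S`. For this, sort by the powerful part `s` (`sum_progression_mul_powerful_le`). The part
`s = 1` is at most `S`, since `sqf |f| ≤ |f|`. For other `s` coprime to `Q` all primes exceed `w`,
so the weights `powerful B s / s` add up to `O(1/w)`. The inner sum over a progression is bounded by
an elementary Shiu-type estimate (`sum_sqf_progression_le`), resting on a Chebyshev bound for primes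
in progressions that loses a factor `log Q`. The resulting error `(log Q / w) X / log T` is
harmless: `log Q ≪ log log N`, while `w > log log N / log log log N` and `Q/φ(Q) ≥ log w ≫ log log
log N`, so `log Q / w ≪ Q/φ(Q)`, and the lower Shiu-type hypothesis contains the factor `Q/φ(Q)`. -/

namespace MultDecomp

open ArithmeticFunction Finset

/-! ### Multiplicative functions given by their values at prime powers -/

/-- The multiplicative function with value `φ p k` at `p ^ k` for primes `p` and `k ≥ 1`. -/
noncomputable def ofPrimePowers (φ : ℕ → ℕ → ℝ) : ArithmeticFunction ℝ :=
  ⟨fun n => if n = 0 then 0 else n.factorization.prod φ, by simp⟩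

theorem ofPrimePowers_apply (φ : ℕ → ℕ → ℝ) {n : ℕ} (hn : n ≠ 0) :
    ofPrimePowers φ n = ∏ p ∈ n.primeFactors, φ p (n.factorization p) := by
  simp [ofPrimePowers, hn, Finsupp.prod]

theorem isMultiplicative_ofPrimePowers (φ : ℕ → ℕ → ℝ) :
    (ofPrimePowers φ).IsMultiplicative := by
  rw [IsMultiplicative.iff_ne_zero]
  refine ⟨by simp [ofPrimePowers], fun {m n} hm hn hmn => ?_⟩
  simp only [ofPrimePowers, coe_mk, hm, hn, mul_ne_zero hm hn, if_false]
  rw [Nat.factorization_mul_of_coprime hmn]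
  refine Finsupp.prod_add_index_of_disjoint ?_ φ
  simpa using hmn.disjoint_primeFactors

theorem ofPrimePowers_prime_pow (φ : ℕ → ℕ → ℝ) {p k : ℕ} (hp : p.Prime) (hk : k ≠ 0) :
    ofPrimePowers φ (p ^ k) = φ p k := by
  rw [ofPrimePowers_apply φ (pow_ne_zero _ hp.ne_zero), Nat.primeFactors_prime_pow hk hp]
  simp [hp.factorization_self]

theorem IsMultiplicative.nonneg_of_prime_pow {u : ArithmeticFunction ℝ} (hu : u.IsMultiplicative)
    (h : ∀ p k : ℕ, p.Prime → k ≠ 0 → 0 ≤ u (p ^ k)) (n : ℕ) : 0 ≤ u n := by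
  rcases eq_or_ne n 0 with rfl | hn
  · simp
  rw [hu.multiplicative_factorization u hn]
  refine prod_nonneg fun p hp => h p _ (Nat.prime_of_mem_primeFactors hp) ?_
  exact Finsupp.mem_support_iff.1 hp

theorem IsMultiplicative.le_of_prime_pow {u v : ArithmeticFunction ℝ} (hu : u.IsMultiplicative)
    (hv : v.IsMultiplicative) (h0 : ∀ n, 0 ≤ u n)
    (h : ∀ p k : ℕ, p.Prime → k ≠ 0 → u (p ^ k) ≤ v (p ^ k)) (n : ℕ) : u n ≤ v n := by
  rcases eq_or_ne n 0 with rfl | hn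
  · simp
  rw [hu.multiplicative_factorization u hn, hv.multiplicative_factorization v hn]
  refine prod_le_prod (fun p _ => h0 _) fun p hp => h p _ (Nat.prime_of_mem_primeFactors hp) ?_
  exact Finsupp.mem_support_iff.1 hp

theorem eq_of_prime_pow {u v : ArithmeticFunction ℝ} (hu : u.IsMultiplicative)
    (hv : v.IsMultiplicative)
    (h : ∀ p k : ℕ, p.Prime → k ≠ 0 → u (p ^ k) = v (p ^ k)) : u = v := by
  rw [IsMultiplicative.eq_iff_eq_on_prime_powers u hu v hv]
  intro p k hp
  rcases eq_or_ne k 0 with rfl | hk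
  · simp [hu.map_one, hv.map_one]
  · exact h p k hp hk

/-! ### Dirichlet convolution: positivity and prime powers -/

theorem conv_nonneg {u v : ArithmeticFunction ℝ} (hu : ∀ n, 0 ≤ u n) (hv : ∀ n, 0 ≤ v n) (n : ℕ) :
    0 ≤ (u * v) n := by
  rw [mul_apply]; exact sum_nonneg fun x _ => mul_nonneg (hu _) (hv _)

theorem conv_le_conv {u v u' v' : ArithmeticFunction ℝ} (hu : ∀ n, 0 ≤ u n) (hv : ∀ n, 0 ≤ v n)
    (huu : ∀ n, u n ≤ u' n) (hvv : ∀ n, v n ≤ v' n) (n : ℕ) : (u * v) n ≤ (u' * v') n := by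
  rw [mul_apply, mul_apply]
  exact sum_le_sum fun x _ => mul_le_mul (huu _) (hvv _) (hv _) ((hu _).trans (huu _))

theorem prod_conv_nonneg {ι : Type*} (s : Finset ι) (u : ι → ArithmeticFunction ℝ)
    (hu : ∀ i n, 0 ≤ u i n) (n : ℕ) : 0 ≤ (∏ i ∈ s, u i) n := by
  induction s using Finset.cons_induction generalizing n with
  | empty => rw [prod_empty, one_apply]; split_ifs <;> norm_num
  | cons a s ha ih => rw [prod_cons]; exact conv_nonneg (hu a) ih n

theorem prod_conv_le {ι : Type*} (s : Finset ι) (u v : ι → ArithmeticFunction ℝ)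
    (hu : ∀ i n, 0 ≤ u i n) (huv : ∀ i n, u i n ≤ v i n) (n : ℕ) :
    (∏ i ∈ s, u i) n ≤ (∏ i ∈ s, v i) n := by
  induction s using Finset.cons_induction generalizing n with
  | empty => simp
  | cons a s ha ih =>
    rw [prod_cons, prod_cons]
    exact conv_le_conv (hu a) (prod_conv_nonneg s u hu) (huv a) ih n

theorem conv_prime_pow (u v : ArithmeticFunction ℝ) {p : ℕ} (hp : p.Prime) (k : ℕ) :
    (u * v) (p ^ k) = ∑ i ∈ range (k + 1), u (p ^ i) * v (p ^ (k - i)) := by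
  rw [mul_apply, Nat.sum_divisorsAntidiagonal (fun x y => u x * v y), Nat.divisors_prime_pow hp,
    sum_map]
  refine sum_congr rfl fun i hi => ?_
  simp only [Function.Embedding.coeFn_mk]
  rw [Nat.pow_div (by simp at hi; omega) hp.pos]

theorem conv_prime (u v : ArithmeticFunction ℝ) (hu : u 1 = 1) (hv : v 1 = 1) {p : ℕ}
    (hp : p.Prime) : (u * v) p = u p + v p := by
  have := conv_prime_pow u v hp 1
  simp only [pow_one] at this
  rw [this, sum_range_succ, sum_range_one]
  simp [hu, hv, add_comm]

theorem prod_conv_prime {ι : Type*} (s : Finset ι) (u : ι → ArithmeticFunction ℝ)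
    (hu : ∀ i ∈ s, (u i).IsMultiplicative) {p : ℕ} (hp : p.Prime) :
    (∏ i ∈ s, u i) p = ∑ i ∈ s, u i p := by
  induction s using Finset.cons_induction with
  | empty => simp [one_apply, hp.ne_one]
  | cons a s ha ih =>
    have hs := isMultiplicative_finsetProd u s (fun i hi => hu i (mem_cons_of_mem hi))
    rw [prod_cons, sum_cons, conv_prime _ _ (hu a (mem_cons_self a s)).map_one hs.map_one hp,
      ih fun i hi => hu i (mem_cons_of_mem hi)]

/-- The convolution at `p ^ k` is bounded by the binomial expansion stripped of its coefficients,
which are at least 1. -/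
theorem abs_conv_prime_pow_le {u v : ArithmeticFunction ℝ} {A B : ℝ} {p : ℕ} (hp : p.Prime)
    (hA : 0 ≤ A) (hu : ∀ k, |u (p ^ k)| ≤ A ^ k) (hv : ∀ k, |v (p ^ k)| ≤ B ^ k) (k : ℕ) :
    |(u * v) (p ^ k)| ≤ (A + B) ^ k := by
  rw [conv_prime_pow u v hp, add_pow]
  refine (abs_sum_le_sum_abs _ _).trans (sum_le_sum fun i hi => ?_)
  have hB : 0 ≤ B ^ (k - i) := (abs_nonneg _).trans (hv _)
  have hi' : i ≤ k := by simp at hi; omega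
  have h1 : (1 : ℝ) ≤ k.choose i := by exact_mod_cast Nat.choose_pos hi'
  rw [abs_mul]
  calc |u (p ^ i)| * |v (p ^ (k - i))| ≤ A ^ i * B ^ (k - i) :=
        mul_le_mul (hu _) (hv _) (abs_nonneg _) (by positivity)
    _ ≤ A ^ i * B ^ (k - i) * k.choose i := le_mul_of_one_le_right (by positivity) h1

theorem abs_prod_conv_prime_pow_le {ι : Type*} (s : Finset ι) (u : ι → ArithmeticFunction ℝ)
    (A : ι → ℝ) {p : ℕ} (hp : p.Prime) (hA : ∀ i ∈ s, 0 ≤ A i)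
    (hu : ∀ i ∈ s, ∀ k, |u i (p ^ k)| ≤ A i ^ k) (k : ℕ) :
    |(∏ i ∈ s, u i) (p ^ k)| ≤ (∑ i ∈ s, A i) ^ k := by
  induction s using Finset.cons_induction generalizing k with
  | empty =>
    rcases eq_or_ne k 0 with rfl | hk
    · simp
    · have : p ^ k ≠ 1 := by simp [hk, hp.ne_one]
      simp [one_apply, hk, hp.ne_one]
  | cons a s ha ih =>
    rw [prod_cons, sum_cons]
    exact abs_conv_prime_pow_le hp (hA a (mem_cons_self a s)) (hu a (mem_cons_self a s))
      (ih (fun i hi => hA i (mem_cons_of_mem hi)) fun i hi => hu i (mem_cons_of_mem hi)) k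

/-! ### Squarefree-supported, completely multiplicative and powerful-supported functions -/

/-- The multiplicative function supported on squarefree numbers with value `a p` at `p`. -/
noncomputable def sqf (a : ℕ → ℝ) : ArithmeticFunction ℝ :=
  ofPrimePowers fun p k => if k = 1 then a p else 0

/-- The completely multiplicative function with value `-a p` at `p`. -/
noncomputable def geo (a : ℕ → ℝ) : ArithmeticFunction ℝ :=
  ofPrimePowers fun p k => (-a p) ^ k

/-- The multiplicative function supported on powerful numbers with value `B ^ k` at `p ^ k`,
`k ≥ 2`. -/
noncomputable def powerful (B : ℝ) : ArithmeticFunction ℝ :=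
  ofPrimePowers fun _ k => if 2 ≤ k then B ^ k else 0

theorem isMultiplicative_sqf (a : ℕ → ℝ) : (sqf a).IsMultiplicative :=
  isMultiplicative_ofPrimePowers _

theorem isMultiplicative_geo (a : ℕ → ℝ) : (geo a).IsMultiplicative :=
  isMultiplicative_ofPrimePowers _

theorem isMultiplicative_powerful (B : ℝ) : (powerful B).IsMultiplicative :=
  isMultiplicative_ofPrimePowers _

theorem sqf_prime_pow (a : ℕ → ℝ) {p k : ℕ} (hp : p.Prime) (hk : k ≠ 0) :
    sqf a (p ^ k) = if k = 1 then a p else 0 := ofPrimePowers_prime_pow _ hp hk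

theorem sqf_prime (a : ℕ → ℝ) {p : ℕ} (hp : p.Prime) : sqf a p = a p := by
  simpa using sqf_prime_pow a hp one_ne_zero

theorem geo_prime_pow (a : ℕ → ℝ) {p : ℕ} (hp : p.Prime) (k : ℕ) :
    geo a (p ^ k) = (-a p) ^ k := by
  rcases eq_or_ne k 0 with rfl | hk
  · simp [(isMultiplicative_geo a).map_one]
  · exact ofPrimePowers_prime_pow _ hp hk

theorem powerful_prime_pow (B : ℝ) {p k : ℕ} (hp : p.Prime) (hk : k ≠ 0) :
    powerful B (p ^ k) = if 2 ≤ k then B ^ k else 0 := ofPrimePowers_prime_pow _ hp hk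

/-- The Euler factors are `1 + a p x` and `1 / (1 + a p x)`. -/
theorem sqf_mul_geo (a : ℕ → ℝ) : sqf a * geo a = 1 := by
  refine eq_of_prime_pow ((isMultiplicative_sqf a).mul (isMultiplicative_geo a))
    isMultiplicative_one fun p k hp hk => ?_
  obtain ⟨k, rfl⟩ := Nat.exists_eq_succ_of_ne_zero hk
  rw [conv_prime_pow _ _ hp, sum_range_succ', sum_range_succ', sum_eq_zero]
  · have h1 : p ^ k.succ ≠ 1 := by simp [hp.ne_one]
    rw [one_apply_ne h1]
    simp only [zero_add, pow_zero, pow_one, (isMultiplicative_sqf a).map_one, sqf_prime a hp,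
      geo_prime_pow a hp, Nat.succ_eq_add_one, Nat.sub_zero, Nat.add_sub_cancel]
    ring
  · intro i _
    rw [sqf_prime_pow a hp (by omega)]
    simp

theorem sqf_of_squarefree (a : ℕ → ℝ) {n : ℕ} (hn : Squarefree n) :
    sqf a n = ∏ p ∈ n.primeFactors, a p := by
  rw [sqf, ofPrimePowers_apply _ hn.ne_zero]
  refine prod_congr rfl fun p hp => ?_
  have hp' := Nat.prime_of_mem_primeFactors hp
  have h1 := hn.natFactorization_le_one p
  have h2 := hp'.factorization_pos_of_dvd hn.ne_zero (Nat.dvd_of_mem_primeFactors hp)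
  exact if_pos (by omega)

theorem sqf_of_not_squarefree (a : ℕ → ℝ) {n : ℕ} (hn : ¬ Squarefree n) : sqf a n = 0 := by
  rcases eq_or_ne n 0 with rfl | h0
  · simp
  rw [Nat.squarefree_iff_factorization_le_one h0] at hn
  push Not at hn
  obtain ⟨p, hp⟩ := hn
  rw [sqf, ofPrimePowers_apply _ h0]
  refine prod_eq_zero (i := p) ?_ (if_neg (by omega))
  rw [← Nat.support_factorization, Finsupp.mem_support_iff]
  omega

theorem squarefree_of_sqf_ne_zero {a : ℕ → ℝ} {n : ℕ} (h : sqf a n ≠ 0) : Squarefree n := by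
  by_contra hn; exact h (sqf_of_not_squarefree a hn)

theorem sqf_nonneg {a : ℕ → ℝ} (ha : ∀ p, 0 ≤ a p) (n : ℕ) : 0 ≤ sqf a n :=
  IsMultiplicative.nonneg_of_prime_pow (isMultiplicative_sqf a)
    (fun p k hp hk => by rw [sqf_prime_pow a hp hk]; split_ifs <;> simp [ha]) n

theorem powerful_nonneg {B : ℝ} (hB : 0 ≤ B) (n : ℕ) : 0 ≤ powerful B n :=
  IsMultiplicative.nonneg_of_prime_pow (isMultiplicative_powerful B)
    (fun p k hp hk => by rw [powerful_prime_pow B hp hk]; split_ifs <;> positivity) n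

/-- A single term of the convolution at `p ^ k` suffices: `sqf a p` when `k = 1`, `powerful B (p ^
k)` when `k ≥ 2`. Thus the values at primes are kept sharp, and only higher powers are treated
crudely. -/
theorem le_sqf_mul_powerful {u : ArithmeticFunction ℝ} (hu : u.IsMultiplicative)
    (hu0 : ∀ n, 0 ≤ u n) {a : ℕ → ℝ} (ha : ∀ p, 0 ≤ a p) {B : ℝ} (hB : 0 ≤ B)
    (h1 : ∀ p : ℕ, p.Prime → u p ≤ a p) (h2 : ∀ p k : ℕ, p.Prime → u (p ^ k) ≤ B ^ k) (n : ℕ) :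
    u n ≤ (sqf a * powerful B) n := by
  refine IsMultiplicative.le_of_prime_pow hu
    ((isMultiplicative_sqf a).mul (isMultiplicative_powerful B)) hu0 (fun p k hp hk => ?_) n
  rw [conv_prime_pow _ _ hp]
  have h0 : ∀ i ∈ range (k + 1), 0 ≤ sqf a (p ^ i) * powerful B (p ^ (k - i)) := fun i _ =>
    mul_nonneg (sqf_nonneg ha _) (powerful_nonneg hB _)
  rcases eq_or_ne k 1 with rfl | hk1
  · refine le_trans ?_ (single_le_sum h0 (show 1 ∈ range 2 by simp))
    simpa [sqf_prime a hp, (isMultiplicative_powerful B).map_one] using h1 p hp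
  · refine le_trans ?_ (single_le_sum h0 (show 0 ∈ range (k + 1) by simp))
    simp only [pow_zero, (isMultiplicative_sqf a).map_one, one_mul, Nat.sub_zero]
    rw [powerful_prime_pow B hp hk, if_pos (by omega)]
    exact h2 p k hp

theorem sqf_mul_prime_le {a : ℕ → ℝ} (ha : ∀ p, 0 ≤ a p) {M : ℝ} {p : ℕ} (hp : p.Prime)
    (hM : a p ≤ M) (b : ℕ) : sqf a (p * b) ≤ M * sqf a b := by
  by_cases hpb : p ∣ b
  · rw [sqf_of_not_squarefree a]
    · exact mul_nonneg ((ha p).trans hM) (sqf_nonneg ha b)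
    · intro h
      have := h p (mul_dvd_mul_left p hpb)
      exact hp.one_lt.ne' (Nat.isUnit_iff.1 this)
  · rw [(isMultiplicative_sqf a).map_mul_of_coprime ((Nat.Prime.coprime_iff_not_dvd hp).2 hpb),
      sqf_prime a hp]
    exact mul_le_mul_of_nonneg_right hM (sqf_nonneg ha b)

/-- Serves Rankin's trick in the number of prime factors. -/
theorem pow_card_mul_sqf_le {a : ℕ → ℝ} (ha : ∀ p, 0 ≤ a p) {M c : ℝ} (hc : 0 ≤ c)
    (hM : ∀ p : ℕ, p.Prime → a p ≤ M) (n : ℕ) :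
    c ^ #n.primeFactors * sqf a n ≤ sqf (fun _ => c * M) n := by
  by_cases hn : Squarefree n
  · rw [sqf_of_squarefree _ hn, sqf_of_squarefree _ hn, ← prod_const, ← prod_mul_distrib]
    refine prod_le_prod (fun p _ => mul_nonneg hc (ha p)) fun p hp => ?_
    exact mul_le_mul_of_nonneg_left (hM p (Nat.prime_of_mem_primeFactors hp)) hc
  · rw [sqf_of_not_squarefree _ hn, sqf_of_not_squarefree _ hn, mul_zero]

/-! ### Weighted sums of Dirichlet convolutions -/

theorem sum_conv_mul (u v : ArithmeticFunction ℝ) (φ : ℕ → ℝ) (X : ℕ) :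
    ∑ n ∈ Icc 1 X, (u * v) n * φ n =
      ∑ a ∈ Icc 1 X, ∑ b ∈ Icc 1 (X / a), u a * v b * φ (a * b) := by
  have key : ∑ n ∈ Icc 1 X, (u * v) n * φ n =
      ∑ x ∈ Icc 1 X ×ˢ Icc 1 X with x.1 * x.2 ≤ X, u x.1 * v x.2 * φ (x.1 * x.2) := by
    trans ∑ n ∈ Icc 1 X, ∑ x ∈ Icc 1 X ×ˢ Icc 1 X with x.1 * x.2 = n,
      u x.1 * v x.2 * φ (x.1 * x.2)
    · refine sum_congr rfl fun n hn => ?_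
      rw [mem_Icc] at hn
      rw [mul_apply, sum_mul, Nat.divisorsAntidiagonal_eq_prod_filter_of_le (N := X) (by omega) hn.2]
      refine sum_congr ?_ fun x hx => ?_
      · ext x; simp [Nat.succ_le_iff]
      · rw [mem_filter] at hx
        rw [hx.2]
    · simp_rw [sum_filter]
      rw [sum_comm]
      refine sum_congr rfl fun x hx => ?_
      simp only [mem_product, mem_Icc] at hx
      have h1 : 1 ≤ x.1 * x.2 := Nat.mul_pos hx.1.1 hx.2.1
      rw [sum_ite_eq]
      simp only [mem_Icc, h1, true_and]
  rw [key, sum_filter, sum_product]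
  refine sum_congr rfl fun a ha => ?_
  rw [mem_Icc] at ha
  rw [← sum_filter]
  refine sum_congr ?_ fun _ _ => rfl
  ext b
  simp only [mem_filter, mem_Icc]
  rw [Nat.le_div_iff_mul_le ha.1, mul_comm b a]
  constructor
  · rintro ⟨⟨h1, h2⟩, h3⟩; exact ⟨h1, h3⟩
  · rintro ⟨h1, h3⟩; exact ⟨⟨h1, (Nat.le_mul_of_pos_left b ha.1).trans h3⟩, h3⟩

/-- Dropping the constraint `a * b ≤ X` only adds nonnegative terms; `P` passes to divisors. -/
theorem sum_conv_div_le {u v : ArithmeticFunction ℝ} (hu : ∀ n, 0 ≤ u n) (hv : ∀ n, 0 ≤ v n)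
    (P : ℕ → Prop) [DecidablePred P] (hP : ∀ a b, P (a * b) → P a ∧ P b) (X : ℕ) :
    ∑ n ∈ Icc 1 X with P n, (u * v) n / n ≤
      (∑ n ∈ Icc 1 X with P n, u n / n) * ∑ n ∈ Icc 1 X with P n, v n / n := by
  have h1 : ∑ n ∈ Icc 1 X with P n, (u * v) n / n =
      ∑ n ∈ Icc 1 X, (u * v) n * (if P n then (n : ℝ)⁻¹ else 0) := by
    rw [sum_filter]
    refine sum_congr rfl fun n _ => ?_
    split_ifs <;> simp [div_eq_mul_inv]
  rw [h1, sum_conv_mul, sum_mul_sum, sum_filter]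
  refine sum_le_sum fun a ha => ?_
  have hnn : ∀ b ∈ Icc 1 X, 0 ≤ u a / a * if P b then v b / b else 0 := fun b _ =>
    mul_nonneg (div_nonneg (hu a) (by positivity))
      (by split_ifs; exacts [div_nonneg (hv b) (by positivity), le_rfl])
  split_ifs with hPa
  · rw [sum_filter]
    simp_rw [← mul_ite_zero]
    calc _ ≤ ∑ b ∈ Icc 1 (X / a), u a / a * if P b then v b / b else 0 := by
          refine sum_le_sum fun b _ => ?_
          by_cases hab : P (a * b)
          · rw [if_pos hab, if_pos (hP a b hab).2]
            push_cast
            rw [mul_inv]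
            apply le_of_eq; ring
          · rw [if_neg hab, mul_zero]
            exact mul_nonneg (div_nonneg (hu a) (by positivity))
              (by split_ifs; exacts [div_nonneg (hv b) (by positivity), le_rfl])
      _ ≤ _ := sum_le_sum_of_subset_of_nonneg
          (Icc_subset_Icc_right (Nat.div_le_self X a)) fun b hb _ => hnn b hb
  · refine le_of_eq (sum_eq_zero fun b _ => ?_)
    rw [if_neg fun h => hPa (hP a b h).1, mul_zero]

theorem sum_zeta_pow_div_le (X : ℕ) (hX : 1 ≤ X) (c : ℕ) :
    ∑ n ∈ Icc 1 X, ((zeta : ArithmeticFunction ℝ) ^ c) n / n ≤ (1 + Real.log X) ^ c := by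
  have hz : ∀ n, 0 ≤ (zeta : ArithmeticFunction ℝ) n := fun n => by
    rw [natCoe_apply]; positivity
  have hlog : 0 ≤ Real.log X := Real.log_natCast_nonneg X
  induction c with
  | zero =>
    rw [pow_zero, pow_zero, sum_eq_single 1]
    · simp
    · intro b _ hb; simp [one_apply_ne hb]
    · simp; omega
  | succ c ih =>
    have hzc : ∀ n, 0 ≤ ((zeta : ArithmeticFunction ℝ) ^ c) n := by
      intro n
      have := prod_conv_nonneg (range c) (fun _ => (zeta : ArithmeticFunction ℝ)) (fun _ => hz) n
      simpa using this
    have h := sum_conv_div_le hzc hz (fun _ => True) (fun _ _ _ => ⟨trivial, trivial⟩) X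
    simp only [filter_true] at h
    rw [pow_succ, pow_succ]
    refine h.trans (mul_le_mul ih ?_ ?_ (by positivity))
    · have hh := harmonic_le_one_add_log X
      rw [harmonic_eq_sum_Icc] at hh
      push_cast at hh
      refine le_trans (le_of_eq (sum_congr rfl fun n hn => ?_)) hh
      rw [mem_Icc] at hn
      rw [natCoe_apply, zeta_apply_ne (by omega)]
      simp
    · exact sum_nonneg fun n _ => div_nonneg (hz n) (by positivity)

/-- Comparison with the divisor function `ζ ^ c`. The bound is crude and serves only for terms where
a large saving is available. -/
theorem sum_sqf_div_le {a : ℕ → ℝ} (ha : ∀ p, 0 ≤ a p) (c : ℕ)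
    (hac : ∀ p : ℕ, p.Prime → a p ≤ c) (X : ℕ) (hX : 1 ≤ X) :
    ∑ n ∈ Icc 1 X, sqf a n / n ≤ (1 + Real.log X) ^ c := by
  refine le_trans (sum_le_sum fun n _ => ?_) (sum_zeta_pow_div_le X hX c)
  refine div_le_div_of_nonneg_right ?_ (by positivity)
  have hz : (zeta : ArithmeticFunction ℝ).IsMultiplicative := isMultiplicative_zeta.natCast
  have hz0 : ∀ n, 0 ≤ (zeta : ArithmeticFunction ℝ) n := fun n => by
    rw [natCoe_apply]; positivity
  refine IsMultiplicative.le_of_prime_pow (isMultiplicative_sqf a) hz.pow (sqf_nonneg ha)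
    (fun p k hp hk => ?_) n
  have hprod : (zeta : ArithmeticFunction ℝ) ^ c =
      ∏ _i ∈ range c, (zeta : ArithmeticFunction ℝ) := by simp
  rw [sqf_prime_pow a hp hk, hprod]
  split_ifs with hk1
  · subst hk1
    rw [pow_one, prod_conv_prime _ _ (fun _ _ => hz) hp]
    simpa [natCoe_apply, zeta_apply_ne hp.ne_zero] using hac p hp
  · exact prod_conv_nonneg _ _ (fun _ => hz0) _

/-! ### Sums over numbers composed of a given finite set of primes -/

/-- Finite Euler product over `P`, followed by `1 + x ≤ exp x` in each factor. -/
theorem sum_le_exp_of_primeFactors_subset {g : ℕ → ℝ} (hg0 : ∀ n, 0 ≤ g n) (hg1 : g 1 = 1)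
    (hmul : ∀ {m n : ℕ}, m.Coprime n → g (m * n) = g m * g n) (P : Finset ℕ)
    (hP : ∀ p ∈ P, p.Prime) (t : ℕ → ℝ)
    (hsum : ∀ p ∈ P, Summable fun k : ℕ => g (p ^ (k + 1)))
    (ht : ∀ p ∈ P, ∑' k : ℕ, g (p ^ (k + 1)) ≤ t p) (S : Finset ℕ)
    (hS : ∀ n ∈ S, n ≠ 0 ∧ n.primeFactors ⊆ P) :
    ∑ n ∈ S, g n ≤ Real.exp (∑ p ∈ P, t p) := by
  classical
  -- The Euler product theorem asks for summability at every prime; cutting `g` off outside `P`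
  -- makes this trivial for the primes not in `P`.
  set g' : ℕ → ℝ := fun n => if n.primeFactors ⊆ P then g n else 0 with hg'
  have hg'0 : ∀ n, 0 ≤ g' n := fun n => by simp only [hg']; split_ifs <;> simp [hg0]
  have hg'1 : g' 1 = 1 := by simp [hg', hg1]
  have hmul' : ∀ {m n : ℕ}, m.Coprime n → g' (m * n) = g' m * g' n := by
    intro m n h
    simp only [hg', h.primeFactors_mul, union_subset_iff]
    by_cases hm : m.primeFactors ⊆ P <;> by_cases hn : n.primeFactors ⊆ P <;>
      simp [hm, hn, hmul h]
  have hpp : ∀ p ∈ P, ∀ k, g' (p ^ k) = g (p ^ k) := by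
    intro p hp k
    refine if_pos ?_
    rcases eq_or_ne k 0 with rfl | hk
    · simp
    · rw [Nat.primeFactors_prime_pow hk (hP p hp)]; simpa using hp
  have hsum' : ∀ {p : ℕ}, p.Prime → Summable fun k : ℕ => ‖g' (p ^ k)‖ := by
    intro p hp
    rw [← summable_nat_add_iff 1]
    by_cases hpP : p ∈ P
    · refine (hsum p hpP).congr fun k => ?_
      rw [Real.norm_of_nonneg (hg'0 _), hpp p hpP]
    · refine summable_zero.congr fun k => ?_
      have : ¬ (p ^ (k + 1)).primeFactors ⊆ P := by
        rw [Nat.primeFactors_prime_pow (by omega) hp]; simpa using hpP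
      simp [hg', this]
  obtain ⟨h1, h2⟩ := EulerProduct.summable_and_hasSum_factoredNumbers_prod_filter_prime_tsum
    hg'1 hmul' hsum' P
  have h3 : ∑ n ∈ S, g n ≤ ∑' m : Nat.factoredNumbers P, g' m := by
    have hmem : ∀ n ∈ S, n ∈ Nat.factoredNumbers P := fun n hn => by
      rw [Nat.mem_factoredNumbers]
      exact ⟨(hS n hn).1, fun p hp => (hS n hn).2 (by simpa using hp)⟩
    have : ∑ n ∈ S, g n = ∑ n ∈ S.subtype (· ∈ Nat.factoredNumbers P), g' n := by
      rw [sum_subtype_of_mem g' hmem]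
      exact sum_congr rfl fun n hn => (if_pos (hS n hn).2).symm
    rw [this]
    exact h2.summable.sum_le_tsum _ fun n _ => hg'0 _
  refine h3.trans ?_
  rw [h2.tsum_eq, filter_true_of_mem hP, Real.exp_sum]
  refine prod_le_prod (fun p _ => tsum_nonneg fun k => hg'0 _) fun p hp => ?_
  have hs : Summable fun k : ℕ => g' (p ^ k) := (hsum' (hP p hp)).of_norm
  rw [hs.tsum_eq_zero_add, pow_zero, hg'1]
  have : ∑' k : ℕ, g' (p ^ (k + 1)) ≤ t p := by
    refine le_trans (le_of_eq (tsum_congr fun k => hpp p hp _)) (ht p hp)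
  calc 1 + ∑' k : ℕ, g' (p ^ (k + 1)) ≤ t p + 1 := by linarith
    _ ≤ _ := Real.add_one_le_exp _

theorem sum_sqf_div_le_exp {a : ℕ → ℝ} (ha : ∀ p, 0 ≤ a p) (T Q : ℕ) :
    ∑ n ∈ Icc 1 T with n.Coprime Q, sqf a n / n ≤
      Real.exp (∑ p ∈ Icc 1 T with p.Prime ∧ ¬ p ∣ Q, a p / p) := by
  refine sum_le_exp_of_primeFactors_subset (g := fun n => sqf a n / n)
    (fun n => div_nonneg (sqf_nonneg ha n) (by positivity))
    (by simp [(isMultiplicative_sqf a).map_one])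
    (fun {m n} h => ?_) _ (fun p hp => (mem_filter.1 hp).2.1) (fun p => a p / p) ?_ ?_ _ ?_
  · simp only [(isMultiplicative_sqf a).map_mul_of_coprime h]
    push_cast
    rw [mul_div_mul_comm]
  · intro p hp
    refine summable_of_ne_finset_zero (s := {0}) fun k hk => ?_
    have hk : k ≠ 0 := by simpa using hk
    rw [sqf_prime_pow a (mem_filter.1 hp).2.1 (by omega), if_neg (by omega), zero_div]
  · intro p hp
    rw [tsum_eq_single 0]
    · simp [sqf_prime a (mem_filter.1 hp).2.1]
    · intro k hk
      rw [sqf_prime_pow a (mem_filter.1 hp).2.1 (by omega), if_neg (by omega), zero_div]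
  · intro n hn
    rw [mem_filter, mem_Icc] at hn
    refine ⟨by omega, fun p hp => ?_⟩
    have hpp := Nat.prime_of_mem_primeFactors hp
    have hpd := Nat.dvd_of_mem_primeFactors hp
    rw [mem_filter, mem_Icc]
    refine ⟨⟨hpp.one_le, (Nat.le_of_dvd (by omega) hpd).trans hn.1.2⟩, hpp, fun h => ?_⟩
    have := Nat.dvd_gcd hpd h
    rw [hn.2.gcd_eq_one] at this
    exact hpp.one_lt.ne' (Nat.dvd_one.1 this)

/-! ### Sums over tuples of given product -/

theorem sum_smul_apply {κ : Type*} (s : Finset κ) (r : κ → ℝ) (u : κ → ArithmeticFunction ℝ)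
    (n : ℕ) : (∑ d ∈ s, r d • u d) n = ∑ d ∈ s, r d * u d n := by
  induction s using Finset.cons_induction with
  | empty => simp
  | cons a s ha ih =>
    rw [sum_cons, sum_cons, ArithmeticFunction.add_apply, ih, smul_map, smul_eq_mul]

/-- With point masses `δ m`, for which `δ a * δ b = δ (a * b)`, a truncated `g i` is a finite sum of
multiples of `δ d`. The product of these sums expands over tuples by distributivity, and truncation
only lowers the convolution. -/
theorem sum_piFinset_le_sum_prod {ι : Type*} [Fintype ι] [DecidableEq ι]
    (g : ι → ArithmeticFunction ℝ) (hg : ∀ i n, 0 ≤ g i n) (φ : ℕ → ℝ) (hφ : ∀ n, 0 ≤ φ n)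
    (T : ℕ) (S : Finset (ι → ℕ)) (hS : ∀ d ∈ S, (∀ i, d i ∈ Icc 1 T) ∧ ∏ i, d i ≤ T) :
    ∑ d ∈ S, (∏ i, g i (d i)) * φ (∏ i, d i) ≤ ∑ n ∈ Icc 1 T, (∏ i, g i) n * φ n := by
  classical
  -- The condition `n ≠ 0` is there because an arithmetic function vanishes at 0.
  let δ : ℕ → ArithmeticFunction ℝ := fun m => ⟨fun n => if m = n ∧ n ≠ 0 then 1 else 0, by simp⟩
  have hδ1 : δ 1 = 1 := by
    ext n; by_cases h : n = 1 <;> simp [δ, h, one_apply, eq_comm]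
  have hδmul : ∀ a b, a ≠ 0 → b ≠ 0 → δ a * δ b = δ (a * b) := by
    intro a b ha hb
    ext n
    rw [mul_apply]
    by_cases h : a * b = n
    · subst h
      rw [sum_eq_single (a, b)]
      · simp [δ, ha, hb]
      · rintro ⟨x, y⟩ _ hne
        simp only [δ, coe_mk]
        by_cases hx : a = x
        · by_cases hy : b = y
          · exact absurd (by rw [hx, hy]) hne
          · simp [hy]
        · simp [hx]
      · intro hh; simp [ha, hb] at hh
    · have : δ (a * b) n = 0 := by simp [δ, h]
      rw [this]
      refine sum_eq_zero fun x hx => ?_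
      rw [Nat.mem_divisorsAntidiagonal] at hx
      simp only [δ, coe_mk]
      by_cases hx1 : a = x.1
      · by_cases hy : b = x.2
        · exact absurd (by rw [hx1, hy, hx.1]) h
        · simp [hy]
      · simp [hx1]
  have hδprod : ∀ (s : Finset ι) (d : ι → ℕ), (∀ i, d i ≠ 0) →
      ∏ i ∈ s, δ (d i) = δ (∏ i ∈ s, d i) := by
    intro s d hd
    induction s using Finset.cons_induction with
    | empty => simp [hδ1]
    | cons a s ha ih =>
      rw [prod_cons, prod_cons, ih, hδmul _ _ (hd a) (prod_ne_zero_iff.2 fun i _ => hd i)]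
  let trunc : ι → ArithmeticFunction ℝ := fun i => ∑ d ∈ Icc 1 T, g i d • δ d
  have heval1 : ∀ (i : ι) (n : ℕ), trunc i n = if n ∈ Icc 1 T then g i n else 0 := by
    intro i n
    rw [sum_smul_apply]
    split_ifs with h
    · rw [sum_eq_single n]
      · rw [mem_Icc] at h
        have : n ≠ 0 := by omega
        simp [δ, this]
      · intro b _ hb; simp [δ, hb]
      · intro h'; exact absurd h h'
    · refine sum_eq_zero fun b hb => ?_
      have : b ≠ n := fun h' => h (h' ▸ hb)
      simp [δ, this]
  have hprod : ∏ i, trunc i =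
      ∑ d ∈ Fintype.piFinset fun _ : ι => Icc 1 T, (∏ i, g i (d i)) • δ (∏ i, d i) := by
    simp only [trunc]
    rw [prod_univ_sum]
    refine sum_congr rfl fun d hd => ?_
    rw [prod_smul, hδprod]
    intro i
    have := Fintype.mem_piFinset.1 hd i
    rw [mem_Icc] at this; omega
  have hle : ∀ n, (∏ i, trunc i) n ≤ (∏ i, g i) n := fun n =>
    prod_conv_le univ trunc g (fun i n => by rw [heval1]; split_ifs <;> simp [hg])
      (fun i n => by rw [heval1]; split_ifs <;> simp [hg]) n
  have hδ0 : ∀ m n, 0 ≤ δ m n := fun m n => by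
    simp only [δ, coe_mk]; split_ifs <;> norm_num
  calc ∑ d ∈ S, (∏ i, g i (d i)) * φ (∏ i, d i)
      = ∑ d ∈ S, ∑ n ∈ Icc 1 T, (∏ i, g i (d i)) * δ (∏ i, d i) n * φ n := by
        refine sum_congr rfl fun d hd => ?_
        have hpos : 0 < ∏ i, d i := prod_pos fun i _ => by
          have := (hS d hd).1 i; rw [mem_Icc] at this; omega
        rw [sum_eq_single (∏ i, d i)]
        · have : δ (∏ i, d i) (∏ i, d i) = 1 := by
            simp only [δ, coe_mk, true_and, if_pos hpos.ne']
          rw [this, mul_one]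
        · intro b _ hb
          have : δ (∏ i, d i) b = 0 := by simp [δ, hb.symm]
          rw [this]; ring
        · intro h
          exact absurd (mem_Icc.2 ⟨hpos, (hS d hd).2⟩) h
    _ = ∑ n ∈ Icc 1 T, (∑ d ∈ S, (∏ i, g i (d i)) * δ (∏ i, d i) n) * φ n := by
        rw [sum_comm]; simp_rw [sum_mul]
    _ ≤ ∑ n ∈ Icc 1 T, (∏ i, g i) n * φ n := by
        refine sum_le_sum fun n _ => mul_le_mul_of_nonneg_right ?_ (hφ n)
        refine le_trans ?_ (hle n)
        rw [hprod, sum_smul_apply]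
        refine sum_le_sum_of_subset_of_nonneg (fun d hd => Fintype.mem_piFinset.2 (hS d hd).1)
          fun d _ _ => mul_nonneg (prod_nonneg fun i _ => hg i _) (hδ0 _ _)

/-! ### Primes in arithmetic progressions -/

theorem prime_pow_dvd_factorial_le {p k K : ℕ} (hp : p.Prime) (h : p ^ k ∣ K.factorial) :
    k ≤ K := by
  rcases Nat.eq_zero_or_pos k with rfl | hk
  · exact Nat.zero_le _
  have h1 := (hp.pow_dvd_factorial_iff (b := Nat.log p K + 1) (by omega)).1 h
  exact h1.trans ((Nat.geom_sum_Ico_le hp.two_le K _).trans (Nat.div_le_self _ _))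

/-- Prime by prime: if `p ∣ Q`, the factor `Q ^ K` suffices, as the exponent of `p` in `K!` is at
most `K`. Otherwise `Q` is invertible modulo `p ^ k`, and the product is `Q ^ K` times a product of
`K` consecutive integers. -/
theorem factorial_dvd_pow_mul_prod (Q b K : ℕ) :
    K.factorial ∣ Q ^ K * ∏ k ∈ range K, (Q * k + b) := by
  rw [Nat.dvd_iff_prime_pow_dvd_dvd]
  intro p k hp hpk
  by_cases hpQ : p ∣ Q
  · refine Dvd.dvd.mul_right ?_ _
    exact (pow_dvd_pow p (prime_pow_dvd_factorial_le hp hpk)).trans (pow_dvd_pow_of_dvd hpQ K)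
  · refine Dvd.dvd.mul_left ?_ _
    have hcop : Q.Coprime (p ^ k) :=
      (((Nat.Prime.coprime_iff_not_dvd hp).2 hpQ).symm).pow_right k
    have : NeZero (p ^ k) := ⟨pow_ne_zero _ hp.ne_zero⟩
    let u := ZMod.unitOfCoprime Q hcop
    let c : ℕ := ((b : ZMod (p ^ k)) * (u⁻¹ : (ZMod (p ^ k))ˣ)).val
    have hc : (Q : ZMod (p ^ k)) * c = b := by
      have h1 : (c : ZMod (p ^ k)) = (b : ZMod (p ^ k)) * (u⁻¹ : (ZMod (p ^ k))ˣ) :=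
        ZMod.natCast_zmod_val _
      have h2 : (Q : ZMod (p ^ k)) = u := (ZMod.coe_unitOfCoprime Q hcop).symm
      rw [h1, h2, mul_comm, mul_assoc, Units.inv_mul, mul_one]
    have h1 : p ^ k ∣ ∏ i ∈ range K, (c + i) := by
      refine hpk.trans ?_
      rw [← Nat.ascFactorial_eq_prod_range]
      exact Nat.factorial_dvd_ascFactorial c K
    rw [← ZMod.natCast_eq_zero_iff] at h1 ⊢
    push_cast at h1 ⊢
    have h2 : ∀ i ∈ range K, (Q : ZMod (p ^ k)) * i + b = Q * (c + i) := fun i _ => by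
      rw [mul_add, hc, add_comm]
    rw [prod_congr rfl h2, prod_mul_distrib, h1, mul_zero]

/-- Chebyshev's argument with `P = ∏ (Q k + b)` in place of a binomial coefficient. The primes above
`K` in the class divide `P` and are coprime to `K!`, so their product `R` satisfies `R * K! ∣ Q ^ K
* P`, whence `R ≤ Q ^ (2 * K)`. The primes up to `K` are covered by the primorial bound. -/
theorem sum_log_prime_progression_le (Q : ℕ) (hQ : 2 ≤ Q) {B : ZMod Q} (hB : IsUnit B)
    (X : ℕ) :
    ∑ p ∈ (Icc 1 X).filter fun p : ℕ => p.Prime ∧ (p : ZMod Q) = B, Real.log p ≤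
      ((X : ℝ) / Q + 1) * (2 * Real.log Q + Real.log 4) := by
  have : NeZero Q := ⟨by omega⟩
  have hlogQ : 0 ≤ Real.log Q := Real.log_natCast_nonneg Q
  set b := B.val with hbdef
  have hbB : (b : ZMod Q) = B := ZMod.natCast_zmod_val B
  have hbQ : b < Q := ZMod.val_lt B
  have hb : b.Coprime Q := by
    rw [← ZMod.isUnit_iff_coprime, hbB]; exact hB
  set K := X / Q + 1 with hK
  set P := ∏ k ∈ range K, (Q * k + b) with hP
  set R := ∏ p ∈ (Icc 1 X).filter fun p : ℕ => (p.Prime ∧ (p : ZMod Q) = B) ∧ K < p, p with hR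
  have hKX : (K : ℝ) ≤ (X : ℝ) / Q + 1 := by
    rw [hK]; push_cast; gcongr; exact Nat.cast_div_le
  have hfac : K.factorial ∣ Q ^ K * P := factorial_dvd_pow_mul_prod Q b K
  have hRP : R ∣ P := by
    rw [hR]
    refine prod_dvd_of_isRelPrime (fun p hp q hq hpq => ?_) fun p hp => ?_
    · simp only [coe_filter, Set.mem_ofPred_eq] at hp hq
      exact Nat.coprime_iff_isRelPrime.1 ((Nat.coprime_primes hp.2.1.1 hq.2.1.1).2 hpq)
    · rw [mem_filter, mem_Icc] at hp
      have hmod : p % Q = b := by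
        rw [hbdef, ← hp.2.1.2, ZMod.val_natCast]
      have hpe : p = Q * (p / Q) + b := by rw [← hmod, Nat.div_add_mod]
      have hmem : p / Q ∈ range K := by
        rw [mem_range, hK, Nat.lt_succ_iff]; exact Nat.div_le_div_right hp.1.2
      conv_lhs => rw [hpe]
      exact dvd_prod_of_mem (fun k => Q * k + b) hmem
  have hcop : R.Coprime K.factorial := by
    rw [hR]
    refine Nat.Coprime.prod_left fun p hp => ?_
    rw [mem_filter] at hp
    rw [Nat.Prime.coprime_iff_not_dvd hp.2.1.1, hp.2.1.1.dvd_factorial]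
    omega
  have hRle : R ≤ Q ^ (2 * K) := by
    have hbpos : 0 < b := Nat.pos_of_ne_zero fun h => by
      rw [h, Nat.coprime_zero_left] at hb; omega
    · have hdvd : R * K.factorial ∣ Q ^ K * P :=
        hcop.mul_dvd_of_dvd_of_dvd (hRP.mul_left _) hfac
      have hPpos : 0 < P := prod_pos fun k _ => by omega
      have hle := Nat.le_of_dvd (by positivity) hdvd
      -- Since `b < Q`, each factor `Q k + b` is at most `Q (k + 1)`.
      have hPle : P ≤ Q ^ K * K.factorial := by
        rw [hP, ← prod_range_add_one_eq_factorial]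
        calc ∏ k ∈ range K, (Q * k + b) ≤ ∏ k ∈ range K, Q * (k + 1) :=
              prod_le_prod' fun k _ => by rw [mul_add, mul_one]; omega
          _ = _ := by rw [prod_mul_distrib]; simp
      have : R * K.factorial ≤ Q ^ (2 * K) * K.factorial := by
        calc R * K.factorial ≤ Q ^ K * (Q ^ K * K.factorial) :=
              hle.trans (Nat.mul_le_mul_left _ hPle)
          _ = _ := by ring
      exact Nat.le_of_mul_le_mul_right this (Nat.factorial_pos K)
  have hlogR : Real.log R ≤ 2 * K * Real.log Q := by
    rcases Nat.eq_zero_or_pos R with h | h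
    · rw [h, Nat.cast_zero, Real.log_zero]; positivity
    · have : (R : ℝ) ≤ (Q : ℝ) ^ (2 * K) := by exact_mod_cast hRle
      have := Real.log_le_log (by exact_mod_cast h) this
      rw [Real.log_pow] at this
      push_cast at this
      exact this
  have hsmall : ∑ p ∈ (Icc 1 X).filter fun p : ℕ => (p.Prime ∧ (p : ZMod Q) = B) ∧ ¬ K < p,
      Real.log p ≤ K * Real.log 4 := by
    have h1 : Real.log (primorial K) ≤ K * Real.log 4 := by
      rw [← Real.log_pow]
      refine Real.log_le_log (by exact_mod_cast primorial_pos K) ?_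
      exact_mod_cast primorial_le_four_pow K
    refine le_trans ?_ h1
    rw [primorial, Nat.cast_prod, Real.log_prod fun p hp => by
      have := (mem_filter.1 hp).2.pos; positivity]
    refine sum_le_sum_of_subset_of_nonneg (fun p hp => ?_) fun p _ _ => Real.log_natCast_nonneg p
    rw [mem_filter] at hp ⊢
    exact ⟨by rw [mem_range]; omega, hp.2.1.1⟩
  have hlarge : ∑ p ∈ (Icc 1 X).filter fun p : ℕ => (p.Prime ∧ (p : ZMod Q) = B) ∧ K < p,
      Real.log p = Real.log R := by
    rw [hR, Nat.cast_prod, Real.log_prod fun p hp => by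
      have := (mem_filter.1 hp).2.1.1.pos; positivity]
  rw [← sum_filter_add_sum_filter_not _ (fun p => K < p), filter_filter, filter_filter, hlarge]
  have h4 : 0 ≤ Real.log 4 := Real.log_nonneg (by norm_num)
  calc _ ≤ 2 * K * Real.log Q + K * Real.log 4 := add_le_add hlogR hsmall
    _ = K * (2 * Real.log Q + Real.log 4) := by ring
    _ ≤ _ := by gcongr

/-! ### The Euler factor of the modulus -/

/-- `Q / φ(Q)` is at least `∏ (1 - 1/p)⁻¹` over `p ≤ k`. Expanded, that product contains `1/n` for
every `n ≤ k`, so it dominates a harmonic sum. -/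
theorem totient_mul_log_le (k Q : ℕ) (hQ : Q ≠ 0) (h : ∀ p : ℕ, p.Prime → p ≤ k → p ∣ Q) :
    (Nat.totient Q : ℝ) * Real.log (k + 1) ≤ Q := by
  let f : ℕ →* ℝ := ⟨⟨fun n => (n : ℝ)⁻¹, by simp⟩, fun a b => by simp [mul_comm]⟩
  have hf : ∀ {p : ℕ}, p.Prime → ‖f p‖ < 1 := fun {p} hp => by
    simp only [f, MonoidHom.coe_mk, OneHom.coe_mk, norm_inv, RCLike.norm_natCast]
    exact inv_lt_one_of_one_lt₀ (by exact_mod_cast hp.one_lt)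
  obtain ⟨h1, h2⟩ :=
    EulerProduct.summable_and_hasSum_smoothNumbers_prod_primesBelow_geometric hf (k + 1)
  have h3 : Real.log (k + 1) ≤ ∏ p ∈ (k + 1).primesBelow, (1 - f p)⁻¹ := by
    rw [← h2.tsum_eq]
    have hmem : ∀ n ∈ Icc 1 k, n ∈ Nat.smoothNumbers (k + 1) := fun n hn => by
      rw [mem_Icc] at hn
      exact Nat.mem_smoothNumbers_of_lt (by omega) (by omega)
    have h4 := log_add_one_le_harmonic k
    rw [harmonic_eq_sum_Icc] at h4
    push_cast at h4
    refine h4.trans ?_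
    have h5 : ∑ n ∈ Icc 1 k, (n : ℝ)⁻¹ =
        ∑ n ∈ (Icc 1 k).subtype (· ∈ Nat.smoothNumbers (k + 1)), f n :=
      (sum_subtype_of_mem (fun n : ℕ => (n : ℝ)⁻¹) hmem).symm
    rw [h5]
    exact h2.summable.sum_le_tsum _ fun n _ => by simp [f]
  have hpos : ∀ p : ℕ, p.Prime → 0 < 1 - f p := fun p hp => by
    have := hf hp
    rw [Real.norm_eq_abs] at this
    linarith [le_abs_self (f p)]
  have h6 : (Nat.totient Q : ℝ) = Q * ∏ p ∈ Q.primeFactors, (1 - f p) := by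
    have := Nat.totient_eq_mul_prod_factors Q
    have := congrArg (fun x : ℚ => (x : ℝ)) this
    push_cast at this
    exact this
  have h7 : ∏ p ∈ Q.primeFactors, (1 - f p) ≤ ∏ p ∈ (k + 1).primesBelow, (1 - f p) := by
    refine prod_le_prod_of_subset_of_le_one (fun p hp => ?_)
      (fun p hp => (hpos p (Nat.prime_of_mem_primeFactors hp)).le) fun p _ _ => ?_
    · rw [Nat.mem_primesBelow] at hp
      rw [Nat.mem_primeFactors]
      exact ⟨hp.2, h p hp.2 (by omega), hQ⟩
    · have : 0 ≤ f p := by simp [f]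
      linarith
  have h8 : 0 < ∏ p ∈ (k + 1).primesBelow, (1 - f p) :=
    prod_pos fun p hp => hpos p (Nat.prime_of_mem_primesBelow hp)
  rw [prod_inv_distrib] at h3
  rw [h6]
  have hlog : 0 ≤ Real.log (k + 1) := Real.log_nonneg (by linarith [Nat.cast_nonneg (α := ℝ) k])
  calc (Q : ℝ) * (∏ p ∈ Q.primeFactors, (1 - f p)) * Real.log (k + 1)
      ≤ Q * (∏ p ∈ (k + 1).primesBelow, (1 - f p)) * (∏ p ∈ (k + 1).primesBelow, (1 - f p))⁻¹ := by
        gcongr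
    _ = Q := by rw [mul_assoc, mul_inv_cancel₀ h8.ne', mul_one]

/-! ### Sums over powerful numbers -/

/-- With `x = B p ^ (-σ) ≤ 1/2`, the Euler factor minus 1 is `x² / (1 - x) ≤ 2 x²`. -/
theorem sum_powerful_rpow_le {B : ℝ} (hB : 0 ≤ B) (σ : ℝ) (T Q : ℕ)
    (hσ : ∀ p : ℕ, p.Prime → ¬ p ∣ Q → B * (p : ℝ) ^ (-σ) ≤ 1 / 2) :
    ∑ n ∈ Icc 1 T with n.Coprime Q, powerful B n * (n : ℝ) ^ (-σ) ≤
      Real.exp (∑ p ∈ Icc 1 T with p.Prime ∧ ¬ p ∣ Q, 2 * (B * (p : ℝ) ^ (-σ)) ^ 2) := by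
  have hval : ∀ p : ℕ, p.Prime → ∀ k : ℕ,
      powerful B (p ^ (k + 1)) * ((p ^ (k + 1) : ℕ) : ℝ) ^ (-σ) =
        if 1 ≤ k then (B * (p : ℝ) ^ (-σ)) ^ (k + 1) else 0 := by
    intro p hp k
    rw [powerful_prime_pow B hp (by omega)]
    have : ((p ^ (k + 1) : ℕ) : ℝ) ^ (-σ) = ((p : ℝ) ^ (-σ)) ^ (k + 1) := by
      rw [Nat.cast_pow, ← Real.rpow_natCast, ← Real.rpow_mul (by positivity), mul_comm,
        Real.rpow_mul (by positivity), Real.rpow_natCast]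
    rw [this]
    by_cases hk : 1 ≤ k
    · rw [if_pos hk, if_pos (by omega), mul_pow]
    · rw [if_neg hk, if_neg (by omega), zero_mul]
  have hhas : ∀ x : ℝ, 0 ≤ x → x ≤ 1 / 2 →
      HasSum (fun k : ℕ => if 1 ≤ k then x ^ (k + 1) else 0) (x ^ 2 * (1 - x)⁻¹) := by
    intro x hx0 hx
    rw [← hasSum_nat_add_iff' 1]
    have := (hasSum_geometric_of_lt_one hx0 (by linarith)).mul_left (x ^ 2)
    simp only [range_one, sum_singleton]
    norm_num
    refine this.congr_fun ?_ 
    intro k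
    ring
  have hx0 : ∀ p : ℕ, 0 ≤ B * (p : ℝ) ^ (-σ) := fun p => by positivity
  refine sum_le_exp_of_primeFactors_subset (g := fun n => powerful B n * (n : ℝ) ^ (-σ))
    (fun n => mul_nonneg (powerful_nonneg hB n) (by positivity))
    (by simp [(isMultiplicative_powerful B).map_one])
    (fun {m n} h => ?_) _ (fun p hp => (mem_filter.1 hp).2.1) _ ?_ ?_ _ ?_
  · simp only [(isMultiplicative_powerful B).map_mul_of_coprime h]
    push_cast
    rw [Real.mul_rpow (by positivity) (by positivity)]
    ring
  · intro p hp
    have hp' := (mem_filter.1 hp).2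
    simp_rw [hval p hp'.1]
    exact (hhas _ (hx0 p) (hσ p hp'.1 hp'.2)).summable
  · intro p hp
    have hp' := (mem_filter.1 hp).2
    simp_rw [hval p hp'.1]
    have hx := hσ p hp'.1 hp'.2
    rw [(hhas _ (hx0 p) hx).tsum_eq, mul_comm]
    refine mul_le_mul_of_nonneg_right ?_ (by positivity)
    rw [inv_le_comm₀ (by linarith) (by norm_num)]
    linarith
  · intro n hn
    rw [mem_filter, mem_Icc] at hn
    refine ⟨by omega, fun p hp => ?_⟩
    have hpp := Nat.prime_of_mem_primeFactors hp
    have hpd := Nat.dvd_of_mem_primeFactors hp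
    rw [mem_filter, mem_Icc]
    refine ⟨⟨hpp.one_le, (Nat.le_of_dvd (by omega) hpd).trans hn.1.2⟩, hpp, fun h => ?_⟩
    have := Nat.dvd_gcd hpd h
    rw [hn.2.gcd_eq_one] at this
    exact hpp.one_lt.ne' (Nat.dvd_one.1 this)

theorem sum_powerful_div_le {B w : ℝ} (hB : 0 ≤ B) (hw : 0 < w) (hBw : 2 * B ≤ w) (T Q : ℕ)
    (hQ : ∀ p : ℕ, p.Prime → ¬ p ∣ Q → w < p) :
    ∑ n ∈ Icc 1 T with n.Coprime Q, powerful B n / n ≤ Real.exp (4 * B ^ 2 / w) := by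
  have h1 := sum_powerful_rpow_le hB 1 T Q fun p hp hpQ => by
    have hp0 := hQ p hp hpQ
    rw [Real.rpow_neg_one, ← div_eq_mul_inv, div_le_iff₀ (by linarith)]
    linarith
  simp only [Real.rpow_neg_one, ← div_eq_mul_inv] at h1
  refine h1.trans (Real.exp_le_exp.2 ?_)
  have h2 : ∀ p : ℕ, 2 * (B / (p : ℝ)) ^ 2 = 2 * B ^ 2 * ((p : ℝ) ^ 2)⁻¹ := fun p => by
    rw [div_pow, div_eq_mul_inv]; ring
  simp_rw [h2]
  rw [← mul_sum]
  have h3 : ∑ p ∈ Icc 1 T with p.Prime ∧ ¬ p ∣ Q, ((p : ℝ) ^ 2)⁻¹ ≤ 2 / (⌊w⌋₊ + 1) := by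
    refine le_trans ?_ (sum_Ioo_inv_sq_le ⌊w⌋₊ (T + 1))
    refine sum_le_sum_of_subset_of_nonneg (fun p hp => ?_) fun _ _ _ => by positivity
    rw [mem_filter, mem_Icc] at hp
    rw [mem_Ioo]
    exact ⟨(Nat.floor_lt hw.le).2 (hQ p hp.2.1 hp.2.2), by omega⟩
  have h4 : 2 / ((⌊w⌋₊ : ℝ) + 1) ≤ 2 / w := by
    gcongr; exact (Nat.lt_floor_add_one w).le
  calc 2 * B ^ 2 * _ ≤ 2 * B ^ 2 * (2 / w) := by gcongr; exact h3.trans h4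
    _ = _ := by ring

/-- Rankin's trick: `1/n ≤ z ^ (-1/4) n ^ (-3/4)` for `n > z`. The exponent `3/4` exceeds `1/2`, so
the sum over powerful numbers still converges. -/
theorem sum_powerful_tail_le {B w z : ℝ} (hB : 1 ≤ B) (hw : (2 * B) ^ 2 ≤ w) (hz : 0 < z)
    (T Q : ℕ) (hQ : ∀ p : ℕ, p.Prime → ¬ p ∣ Q → w < p) :
    ∑ n ∈ (Icc 1 T).filter fun n : ℕ => n.Coprime Q ∧ z < n, powerful B n / n ≤
      z ^ (-(1 / 4) : ℝ) * Real.exp (2 * B ^ 2 * ∑' n : ℕ, (n : ℝ) ^ (-(3 / 2) : ℝ)) := by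
  have hs : Summable fun n : ℕ => (n : ℝ) ^ (-(3 / 2) : ℝ) :=
    Real.summable_nat_rpow.2 (by norm_num)
  have h1 := sum_powerful_rpow_le (zero_le_one.trans hB) (3 / 4) T Q fun p hp hpQ => by
    have hp0 := hQ p hp hpQ
    have hp1 : (1 : ℝ) ≤ p := by exact_mod_cast hp.one_le
    have h2 : 2 * B ≤ (p : ℝ) ^ (3 / 4 : ℝ) := by
      calc 2 * B = ((2 * B) ^ 2) ^ (1 / 2 : ℝ) := by
            rw [← Real.sqrt_eq_rpow, Real.sqrt_sq (by linarith)]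
        _ ≤ (p : ℝ) ^ (1 / 2 : ℝ) := by
            apply Real.rpow_le_rpow (by positivity) (by linarith) (by norm_num)
        _ ≤ _ := Real.rpow_le_rpow_of_exponent_le hp1 (by norm_num)
    rw [Real.rpow_neg (by positivity), ← div_eq_mul_inv, div_le_iff₀ (by positivity)]
    linarith
  have h2 : ∑ p ∈ Icc 1 T with p.Prime ∧ ¬ p ∣ Q, 2 * (B * (p : ℝ) ^ (-(3 / 4) : ℝ)) ^ 2 ≤
      2 * B ^ 2 * ∑' n : ℕ, (n : ℝ) ^ (-(3 / 2) : ℝ) := by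
    have h3 : ∀ p : ℕ, 2 * (B * (p : ℝ) ^ (-(3 / 4) : ℝ)) ^ 2 =
        2 * B ^ 2 * (p : ℝ) ^ (-(3 / 2) : ℝ) := fun p => by
      rw [mul_pow, ← Real.rpow_natCast ((p : ℝ) ^ _), ← Real.rpow_mul (by positivity), ← mul_assoc]
      norm_num
    simp_rw [h3]
    rw [← mul_sum]
    gcongr
    exact hs.sum_le_tsum _ fun n _ => by positivity
  calc ∑ n ∈ (Icc 1 T).filter fun n : ℕ => n.Coprime Q ∧ z < n, powerful B n / n
      ≤ ∑ n ∈ (Icc 1 T).filter fun n : ℕ => n.Coprime Q ∧ z < n,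
          z ^ (-(1 / 4) : ℝ) * (powerful B n * (n : ℝ) ^ (-(3 / 4) : ℝ)) := by
        refine sum_le_sum fun n hn => ?_
        rw [mem_filter, mem_Icc] at hn
        have hn0 : (0 : ℝ) < n := by exact_mod_cast hn.1.1
        have : (n : ℝ)⁻¹ ≤ z ^ (-(1 / 4) : ℝ) * (n : ℝ) ^ (-(3 / 4) : ℝ) := by
          have e : (n : ℝ)⁻¹ = (n : ℝ) ^ (-(1 / 4) : ℝ) * (n : ℝ) ^ (-(3 / 4) : ℝ) := by
            rw [← Real.rpow_add hn0, ← Real.rpow_neg_one]; norm_num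
          rw [e]
          refine mul_le_mul_of_nonneg_right ?_ (by positivity)
          exact Real.rpow_le_rpow_of_nonpos hz hn.2.2.le (by norm_num)
        calc powerful B n / n = powerful B n * (n : ℝ)⁻¹ := div_eq_mul_inv _ _
          _ ≤ powerful B n * (z ^ (-(1 / 4) : ℝ) * (n : ℝ) ^ (-(3 / 4) : ℝ)) :=
            mul_le_mul_of_nonneg_left this (powerful_nonneg (by linarith) n)
          _ = _ := by ring
    _ ≤ z ^ (-(1 / 4) : ℝ) * ∑ n ∈ Icc 1 T with n.Coprime Q,
          powerful B n * (n : ℝ) ^ (-(3 / 4) : ℝ) := by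
        rw [← mul_sum]
        refine mul_le_mul_of_nonneg_left (sum_le_sum_of_subset_of_nonneg (fun n hn => ?_)
          fun n _ _ => mul_nonneg (powerful_nonneg (zero_le_one.trans hB) n) (by positivity))
          (by positivity)
        rw [mem_filter] at hn ⊢
        exact ⟨hn.1, hn.2.1⟩
    _ ≤ _ := by
        gcongr
        exact h1.trans (Real.exp_le_exp.2 h2)

/-! ### Squarefree-supported multiplicative functions in progressions -/

/-- The function with value `log p` at primes `p > Q` and `0` elsewhere. -/
noncomputable def primeLog (Q : ℕ) : ArithmeticFunction ℝ :=
  ⟨fun p => if p.Prime ∧ Q < p then Real.log p else 0, by simp⟩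

theorem primeLog_apply (Q p : ℕ) :
    primeLog Q p = if p.Prime ∧ Q < p then Real.log p else 0 := rfl

theorem primeLog_nonneg (Q p : ℕ) : 0 ≤ primeLog Q p := by
  rw [primeLog_apply]; split_ifs; exacts [Real.log_natCast_nonneg p, le_rfl]

/-- Removing a prime `p ∣ r` costs at most a factor `M`, so each summand is dominated by the divisor
pair `(r / p, p)`. -/
theorem sqf_mul_sum_log_le {a : ℕ → ℝ} (ha : ∀ p, 0 ≤ a p) {M : ℝ}
    (hM : ∀ p : ℕ, p.Prime → a p ≤ M) (Q : ℕ) {r : ℕ} (hr : r ≠ 0) :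
    sqf a r * ∑ p ∈ r.primeFactors with Q < p, Real.log p ≤ M * (sqf a * primeLog Q) r := by
  have hM0 : 0 ≤ M := (ha 2).trans (hM 2 Nat.prime_two)
  rw [mul_apply, Nat.sum_divisorsAntidiagonal' (fun x y => sqf a x * primeLog Q y), mul_sum,
    mul_sum]
  calc ∑ p ∈ r.primeFactors with Q < p, sqf a r * Real.log p
      ≤ ∑ p ∈ r.primeFactors with Q < p, M * (sqf a (r / p) * primeLog Q p) := by
        refine sum_le_sum fun p hp => ?_
        rw [mem_filter] at hp
        have hpp := Nat.prime_of_mem_primeFactors hp.1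
        have hpd := Nat.dvd_of_mem_primeFactors hp.1
        rw [primeLog_apply, if_pos ⟨hpp, hp.2⟩, ← mul_assoc]
        refine mul_le_mul_of_nonneg_right ?_ (Real.log_natCast_nonneg p)
        conv_lhs => rw [← Nat.mul_div_cancel' hpd]
        exact sqf_mul_prime_le ha hpp (hM p hpp) _
    _ ≤ _ := by
        refine sum_le_sum_of_subset_of_nonneg (fun p hp => ?_) fun p _ _ =>
          mul_nonneg hM0 (mul_nonneg (sqf_nonneg ha _) (primeLog_nonneg Q p))
        rw [mem_filter] at hp
        exact Nat.mem_divisors.2 ⟨Nat.dvd_of_mem_primeFactors hp.1, hr⟩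

theorem sum_sqf_mul_primeLog_le {a : ℕ → ℝ} (ha : ∀ p, 0 ≤ a p) (Q : ℕ) (hQ : 2 ≤ Q)
    {B : ZMod Q} (hB : IsUnit B) (Y : ℕ) :
    ∑ r ∈ (Icc 1 Y).filter (fun r : ℕ => (r : ZMod Q) = B), (sqf a * primeLog Q) r ≤
      2 * Y / Q * (2 * Real.log Q + Real.log 4) *
        ∑ r ∈ Icc 1 Y with r.Coprime Q, sqf a r / r := by
  have hQ0 : (0 : ℝ) < Q := by exact_mod_cast (by omega : 0 < Q)
  have hlogQ : 0 ≤ Real.log Q := Real.log_natCast_nonneg Q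
  have hlog4 : 0 ≤ Real.log 4 := Real.log_nonneg (by norm_num)
  have h1 : ∑ r ∈ (Icc 1 Y).filter (fun r : ℕ => (r : ZMod Q) = B), (sqf a * primeLog Q) r =
      ∑ r ∈ Icc 1 Y, (sqf a * primeLog Q) r * (if (r : ZMod Q) = B then 1 else 0) := by
    rw [sum_filter]
    exact sum_congr rfl fun r _ => by split_ifs <;> simp
  rw [h1, sum_conv_mul, sum_filter, mul_sum]
  refine sum_le_sum fun b hb => ?_
  rw [mem_Icc] at hb
  have hb0 : (0 : ℝ) < b := by exact_mod_cast hb.1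
  split_ifs with hbQ
  · let u := ZMod.unitOfCoprime b hbQ
    have hu : (b : ZMod Q) = u := (ZMod.coe_unitOfCoprime b hbQ).symm
    set B' : ZMod Q := ((u⁻¹ : (ZMod Q)ˣ) : ZMod Q) * B with hB'
    have hB'u : IsUnit B' := (Units.isUnit _).mul hB
    have hiff : ∀ p : ℕ, ((b * p : ℕ) : ZMod Q) = B ↔ (p : ZMod Q) = B' := by
      intro p
      rw [hB', Units.eq_inv_mul_iff_mul_eq, ← hu]
      push_cast
      rfl
    have h2 : ∑ p ∈ Icc 1 (Y / b), primeLog Q p * (if (p : ZMod Q) = B' then 1 else 0) ≤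
        2 * (Y / b : ℝ) / Q * (2 * Real.log Q + Real.log 4) := by
      by_cases hYb : Y / b ≤ Q
      · rw [sum_eq_zero]
        · positivity
        · intro p hp
          rw [mem_Icc] at hp
          rw [primeLog_apply, if_neg (by omega), zero_mul]
      · push Not at hYb
        have h3 : ((Y / b : ℕ) : ℝ) ≤ (Y : ℝ) / b := Nat.cast_div_le
        have h4 : (Q : ℝ) ≤ (Y / b : ℕ) := by exact_mod_cast hYb.le
        calc _ ≤ ∑ p ∈ (Icc 1 (Y / b)).filter fun p : ℕ => p.Prime ∧ (p : ZMod Q) = B',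
                Real.log p := by
              rw [sum_filter]
              refine sum_le_sum fun p _ => ?_
              rw [primeLog_apply]
              have := Real.log_natCast_nonneg p
              split_ifs with h5 h6 h7 h8 <;> first | simp; done | simp_all
          _ ≤ (((Y / b : ℕ) : ℝ) / Q + 1) * (2 * Real.log Q + Real.log 4) :=
              sum_log_prime_progression_le Q hQ hB'u _
          _ ≤ _ := by
              refine mul_le_mul_of_nonneg_right ?_ (by positivity)
              have h5 : 1 ≤ ((Y : ℝ) / b) / Q := by
                rw [le_div_iff₀ hQ0]; linarith
              have h6 : ((Y / b : ℕ) : ℝ) / Q ≤ ((Y : ℝ) / b) / Q := by gcongr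
              rw [mul_div_assoc]
              linarith
    simp_rw [hiff, mul_assoc]
    rw [← mul_sum]
    calc sqf a b * _ ≤ sqf a b * (2 * (Y / b : ℝ) / Q * (2 * Real.log Q + Real.log 4)) :=
          mul_le_mul_of_nonneg_left h2 (sqf_nonneg ha b)
      _ = _ := by field_simp
  · rw [mul_zero]
    refine le_of_eq (sum_eq_zero fun p _ => ?_)
    rw [if_neg, mul_zero]
    intro h
    have : IsUnit ((b * p : ℕ) : ZMod Q) := h ▸ hB
    rw [ZMod.isUnit_iff_coprime] at this
    exact hbQ (Nat.Coprime.coprime_mul_right this)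

/-- The three terms account for `r ≤ √Y`, for `r` with at least `k₀ = log Y / (4 log Q)` prime
factors, and for the remaining `r`. A remaining `r` has `log r ≥ log Y / 2`, and its primes up to
`Q` contribute at most `k₀ log Q = log Y / 4`. Hence its primes above `Q` contribute at least `log Y
/ 4`, and one of them can be summed over a progression. -/
theorem sum_sqf_progression_le {a : ℕ → ℝ} (ha : ∀ p, 0 ≤ a p) {H : ℕ}
    (haH : ∀ p : ℕ, p.Prime → a p ≤ H) (Q : ℕ) (hQ : 2 ≤ Q) {B : ZMod Q} (hB : IsUnit B)
    (Y : ℕ) (hY : 2 ≤ Y) :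
    ∑ r ∈ (Icc 1 Y).filter (fun r : ℕ => (r : ZMod Q) = B), sqf a r ≤
      √Y * (1 + Real.log Y) ^ H +
      Real.exp (-(Real.log Y / (4 * Real.log Q))) * Y * (1 + Real.log Y) ^ (3 * H) +
      4 / Real.log Y * H * (2 * Y / Q * (2 * Real.log Q + Real.log 4) *
        ∑ r ∈ Icc 1 Y with r.Coprime Q, sqf a r / r) := by
  have hlogQ : 0 < Real.log Q := Real.log_pos (by exact_mod_cast hQ)
  have hlogY : 0 < Real.log Y := Real.log_pos (by exact_mod_cast hY)
  set k₀ := Real.log Y / (4 * Real.log Q) with hk₀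
  have hG := sqf_nonneg ha
  have hG3 : ∀ n, 0 ≤ sqf (fun _ => 3 * (H : ℝ)) n := sqf_nonneg fun _ => by positivity
  have hLam : ∀ r : ℕ, 0 ≤ ∑ p ∈ r.primeFactors with Q < p, Real.log p := fun r =>
    sum_nonneg fun p _ => Real.log_natCast_nonneg p
  have hpt : ∀ r ∈ Icc 1 Y, sqf a r ≤ √Y * (sqf a r / r) +
      Real.exp (-k₀) * Y * (sqf (fun _ => 3 * (H : ℝ)) r / r) +
      4 / Real.log Y * (sqf a r * ∑ p ∈ r.primeFactors with Q < p, Real.log p) := by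
    intro r hr
    rw [mem_Icc] at hr
    have hr0 : (0 : ℝ) < r := by exact_mod_cast hr.1
    have hrY : (r : ℝ) ≤ Y := by exact_mod_cast hr.2
    have t1 : 0 ≤ √Y * (sqf a r / r) :=
      mul_nonneg (Real.sqrt_nonneg _) (div_nonneg (hG r) hr0.le)
    have t2 : 0 ≤ Real.exp (-k₀) * Y * (sqf (fun _ => 3 * (H : ℝ)) r / r) :=
      mul_nonneg (by positivity) (div_nonneg (hG3 r) hr0.le)
    have t3 : 0 ≤ 4 / Real.log Y *
        (sqf a r * ∑ p ∈ r.primeFactors with Q < p, Real.log p) :=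
      mul_nonneg (by positivity) (mul_nonneg (hG r) (hLam r))
    by_cases hsq : Squarefree r
    swap
    · rw [sqf_of_not_squarefree a hsq] at t1 t3 ⊢
      linarith
    by_cases hr1 : (r : ℝ) ≤ √Y
    · have : sqf a r ≤ √Y * (sqf a r / r) := by
        rw [mul_div_assoc', le_div_iff₀ hr0, mul_comm]
        exact mul_le_mul_of_nonneg_right hr1 (hG r)
      linarith
    push Not at hr1
    by_cases hω : k₀ ≤ #r.primeFactors
    -- Rankin's trick in the number of prime factors, with `e < 3` to keep an integer base.
    · have h1 : Real.exp k₀ * sqf a r ≤ sqf (fun _ => 3 * (H : ℝ)) r := by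
        refine le_trans ?_ (pow_card_mul_sqf_le ha (by norm_num : (0 : ℝ) ≤ 3) haH r)
        refine mul_le_mul_of_nonneg_right ?_ (hG r)
        calc Real.exp k₀ ≤ Real.exp (#r.primeFactors) := Real.exp_le_exp.2 hω
          _ = Real.exp 1 ^ #r.primeFactors := by rw [← Real.exp_nat_mul, mul_one]
          _ ≤ 3 ^ #r.primeFactors := by
            gcongr; linarith [Real.exp_one_lt_d9]
      have h2 : sqf a r ≤ Real.exp (-k₀) * Y * (sqf (fun _ => 3 * (H : ℝ)) r / r) := by
        calc sqf a r = Real.exp (-k₀) * (Real.exp k₀ * sqf a r) := by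
              rw [← mul_assoc, ← Real.exp_add]; simp
          _ ≤ Real.exp (-k₀) * sqf (fun _ => 3 * (H : ℝ)) r := by gcongr
          _ ≤ Real.exp (-k₀) * sqf (fun _ => 3 * (H : ℝ)) r * (Y / r) :=
              le_mul_of_one_le_right (mul_nonneg (Real.exp_pos _).le (hG3 r))
                ((one_le_div hr0).2 hrY)
          _ = _ := by ring
      linarith
    push Not at hω
    have h1 : Real.log r = ∑ p ∈ r.primeFactors, Real.log p := by
      conv_lhs => rw [← Nat.prod_primeFactors_of_squarefree hsq]
      rw [Nat.cast_prod, Real.log_prod fun p hp => by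
        have := (Nat.prime_of_mem_primeFactors hp).pos; positivity]
    have h2 : Real.log Y / 2 ≤ Real.log r := by
      rw [← Real.log_sqrt (by positivity)]
      exact Real.log_le_log (Real.sqrt_pos.2 (by positivity)) hr1.le
    have h3 : ∑ p ∈ r.primeFactors with ¬ Q < p, Real.log p ≤ Real.log Y / 4 := by
      calc ∑ p ∈ r.primeFactors with ¬ Q < p, Real.log p
          ≤ ∑ p ∈ r.primeFactors with ¬ Q < p, Real.log Q := by
            refine sum_le_sum fun p hp => ?_
            rw [mem_filter] at hp
            exact Real.log_le_log
              (by exact_mod_cast (Nat.prime_of_mem_primeFactors hp.1).pos)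
              (by exact_mod_cast not_lt.1 hp.2)
        _ ≤ ∑ p ∈ r.primeFactors, Real.log Q :=
            sum_le_sum_of_subset_of_nonneg (filter_subset _ _) fun _ _ _ => hlogQ.le
        _ = #r.primeFactors * Real.log Q := by rw [sum_const, nsmul_eq_mul]
        _ ≤ k₀ * Real.log Q := by gcongr
        _ = _ := by rw [hk₀]; field_simp
    have h4 : Real.log Y / 4 ≤ ∑ p ∈ r.primeFactors with Q < p, Real.log p := by
      have := sum_filter_add_sum_filter_not r.primeFactors (fun p => Q < p)
        (fun p => Real.log (p : ℝ))
      linarith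
    have h5 : sqf a r ≤ 4 / Real.log Y *
        (sqf a r * ∑ p ∈ r.primeFactors with Q < p, Real.log p) := by
      calc sqf a r = 4 / Real.log Y * (sqf a r * (Real.log Y / 4)) := by field_simp
        _ ≤ _ := by
          refine mul_le_mul_of_nonneg_left ?_ (by positivity)
          exact mul_le_mul_of_nonneg_left h4 (hG r)
    linarith
  have hsub : (Icc 1 Y).filter (fun r : ℕ => (r : ZMod Q) = B) ⊆ Icc 1 Y := filter_subset _ _
  refine (sum_le_sum fun r hr => hpt r (hsub hr)).trans ?_
  rw [sum_add_distrib, sum_add_distrib, ← mul_sum, ← mul_sum, ← mul_sum]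
  refine add_le_add (add_le_add ?_ ?_) ?_
  · refine mul_le_mul_of_nonneg_left ?_ (Real.sqrt_nonneg _)
    exact (sum_le_sum_of_subset_of_nonneg hsub fun r _ _ => div_nonneg (hG r) (by positivity)).trans
      (sum_sqf_div_le ha H haH Y (by omega))
  · refine mul_le_mul_of_nonneg_left ?_ (by positivity)
    refine (sum_le_sum_of_subset_of_nonneg hsub fun r _ _ =>
      div_nonneg (hG3 r) (by positivity)).trans ?_
    exact sum_sqf_div_le (fun _ => by positivity) (3 * H) (fun _ _ => by push_cast; rfl) Y
      (by omega)
  · rw [mul_assoc]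
    refine mul_le_mul_of_nonneg_left ?_ (by positivity)
    calc _ ≤ ∑ r ∈ (Icc 1 Y).filter (fun r : ℕ => (r : ZMod Q) = B),
            H * (sqf a * primeLog Q) r := by
          refine sum_le_sum fun r hr => sqf_mul_sum_log_le ha haH Q ?_
          have := mem_Icc.1 (hsub hr); omega
      _ ≤ _ := by
          rw [← mul_sum]
          exact mul_le_mul_of_nonneg_left (sum_sqf_mul_primeLog_le ha Q hQ hB Y) (by positivity)

/-! ### The powerful part -/

theorem exp_sub_one_le_two_mul {x : ℝ} (h0 : 0 ≤ x) (h1 : x ≤ 1) : Real.exp x - 1 ≤ 2 * x := by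
  have := Real.abs_exp_sub_one_sub_id_le (x := x) (by rwa [abs_of_nonneg h0])
  have h2 := (abs_le.1 this).2
  nlinarith

-- Write `m = s r` with weight `powerful B s`. The term `s = 1` is kept as it stands; `1 < s ≤ z`
-- uses `sum_sqf_progression_le` at length `T / s ≥ y`, with total weight `O(B² / w)`; `s > z` uses
-- the trivial bound and the tail of the powerful sum.
set_option maxHeartbeats 800000 in
theorem sum_progression_mul_powerful_le {a : ℕ → ℝ} (ha : ∀ p, 0 ≤ a p) {H : ℕ}
    (haH : ∀ p : ℕ, p.Prime → a p ≤ H) {Q : ℕ} (hQ : 2 ≤ Q) {A : ZMod Q} (hA : IsUnit A)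
    {T : ℕ} (hT : 2 ≤ T) {B w z y κ : ℝ} (hB : 1 ≤ B) (hw : (2 * B) ^ 2 ≤ w) (hz : 1 ≤ z)
    (hQw : ∀ p : ℕ, p.Prime → ¬ p ∣ Q → w < p) (hy : 2 ≤ y)
    (hyT : ∀ s : ℕ, 1 ≤ s → (s : ℝ) ≤ z → y ≤ (T / s : ℕ))
    (h1 : Q * Real.log T * (1 + Real.log T) ^ H ≤ √y)
    (h2 : Real.exp (-(Real.log y / (4 * Real.log Q))) * (1 + Real.log T) ^ (3 * H) *
      (Q * Real.log T) ≤ 1)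
    (h3 : Q * (1 + Real.log T) ^ H * z ^ (-(1 / 4) : ℝ) * Real.log T ≤ 1)
    (h4 : Real.log T ≤ κ * Real.log y) :
    (Q : ℝ) / T * ∑ m ∈ (Icc 1 T).filter (fun m : ℕ => (m : ZMod Q) = A),
        (sqf a * powerful B) m ≤
      (Q : ℝ) / T * ∑ m ∈ (Icc 1 T).filter (fun m : ℕ => (m : ZMod Q) = A), sqf a m +
      (4 + Real.exp (2 * B ^ 2 * ∑' n : ℕ, (n : ℝ) ^ (-(3 / 2) : ℝ))) / Real.log T +
      256 * B ^ 2 * H * κ * (Real.log Q / w) *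
        (Real.exp (∑ p ∈ Icc 1 T with p.Prime ∧ ¬ p ∣ Q, a p / p) / Real.log T) := by
  have hG := sqf_nonneg ha
  have hB0 : 0 ≤ B := zero_le_one.trans hB
  have he := powerful_nonneg hB0
  have hT0 : (0 : ℝ) < T := by exact_mod_cast (by omega : 0 < T)
  have hQ0 : (0 : ℝ) < Q := by exact_mod_cast (by omega : 0 < Q)
  have hlogT : 0 < Real.log T := Real.log_pos (by exact_mod_cast hT)
  have hlogQ : 0 < Real.log Q := Real.log_pos (by exact_mod_cast hQ)
  have hlogy : 0 < Real.log y := Real.log_pos (by linarith)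
  have hw0 : 0 < w := lt_of_lt_of_le (by positivity) hw
  have hκ : 0 < κ := by
    by_contra h
    push Not at h
    nlinarith
  set L := Real.log T with hL
  set X := Real.exp (∑ p ∈ Icc 1 T with p.Prime ∧ ¬ p ∣ Q, a p / p) with hX
  have hX0 : 0 < X := Real.exp_pos _
  -- Bound for the inner sum in units of `T / (s Q)`: the first two terms of
  -- `sum_sqf_progression_le` give `1 / L` each, and the third gives `32 = 4 * 2 * 4`, using `log 4
  -- ≤ 2 log Q`.
  set c := 2 / L + 32 * H * κ * Real.log Q * (X / L) with hc
  have hc0 : 0 ≤ c := by positivity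
  let I : ℕ → ℝ := fun s => ∑ r ∈ Icc 1 (T / s), sqf a r * if ((s * r : ℕ) : ZMod Q) = A then 1 else 0
  have hsum : ∑ m ∈ (Icc 1 T).filter (fun m : ℕ => (m : ZMod Q) = A), (sqf a * powerful B) m =
      ∑ s ∈ Icc 1 T, powerful B s * I s := by
    rw [sum_filter, mul_comm (sqf a)]
    have := sum_conv_mul (powerful B) (sqf a) (fun m => if (m : ZMod Q) = A then 1 else 0) T
    simp only [mul_ite, mul_one, mul_zero] at this
    rw [this]
    refine sum_congr rfl fun s _ => ?_
    rw [mul_sum]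
    refine sum_congr rfl fun r _ => ?_
    simp only [mul_ite, mul_one, mul_zero]
  have hI1 : I 1 = ∑ m ∈ (Icc 1 T).filter (fun m : ℕ => (m : ZMod Q) = A), sqf a m := by
    simp only [I, Nat.div_one, one_mul, sum_filter]
    exact sum_congr rfl fun r _ => by simp only [mul_ite, mul_one, mul_zero]
  have hInc : ∀ s : ℕ, ¬ s.Coprime Q → I s = 0 := by
    intro s hs
    refine sum_eq_zero fun r _ => ?_
    rw [if_neg, mul_zero]
    intro h
    have : IsUnit ((s * r : ℕ) : ZMod Q) := h ▸ hA
    rw [ZMod.isUnit_iff_coprime] at this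
    exact hs (Nat.Coprime.coprime_mul_right this)
  have hIbig : ∀ s ∈ Icc 1 T, I s ≤ (T : ℝ) / s * (1 + L) ^ H := by
    intro s hs
    rw [mem_Icc] at hs
    have hTs : 1 ≤ T / s := (Nat.one_le_div_iff hs.1).2 hs.2
    have hTs' : ((T / s : ℕ) : ℝ) ≤ (T : ℝ) / s := Nat.cast_div_le
    calc I s ≤ ∑ r ∈ Icc 1 (T / s), (T : ℝ) / s * (sqf a r / r) := by
          refine sum_le_sum fun r hr => ?_
          rw [mem_Icc] at hr
          have hr0 : (0 : ℝ) < r := by exact_mod_cast hr.1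
          have hr1 : (r : ℝ) ≤ (T / s : ℕ) := by exact_mod_cast hr.2
          calc sqf a r * (if ((s * r : ℕ) : ZMod Q) = A then 1 else 0) ≤ sqf a r * 1 := by
                refine mul_le_mul_of_nonneg_left ?_ (hG r)
                split_ifs <;> norm_num
            _ ≤ sqf a r * ((T : ℝ) / s / r) := by
                refine mul_le_mul_of_nonneg_left ?_ (hG r)
                rw [one_le_div hr0]; linarith
            _ = _ := by ring
      _ = (T : ℝ) / s * ∑ r ∈ Icc 1 (T / s), sqf a r / r := by rw [mul_sum]
      _ ≤ (T : ℝ) / s * (1 + Real.log (T / s : ℕ)) ^ H := by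
          refine mul_le_mul_of_nonneg_left ?_ (by positivity)
          exact sum_sqf_div_le ha H haH _ hTs
      _ ≤ _ := by
          have h5 : 0 ≤ Real.log ((T / s : ℕ) : ℝ) := Real.log_natCast_nonneg _
          have h6 : Real.log ((T / s : ℕ) : ℝ) ≤ L :=
            Real.log_le_log (by exact_mod_cast hTs) (by exact_mod_cast Nat.div_le_self T s)
          gcongr
  have hIsmall : ∀ s ∈ Icc 1 T, s.Coprime Q → (s : ℝ) ≤ z → I s ≤ (T : ℝ) / s / Q * c := by
    intro s hs hsQ hsz
    rw [mem_Icc] at hs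
    have hs0 : (0 : ℝ) < s := by exact_mod_cast hs.1
    let u := ZMod.unitOfCoprime s hsQ
    have hu : (s : ZMod Q) = u := (ZMod.coe_unitOfCoprime s hsQ).symm
    set A' : ZMod Q := ((u⁻¹ : (ZMod Q)ˣ) : ZMod Q) * A with hA'
    have hA'u : IsUnit A' := (Units.isUnit _).mul hA
    have hiff : ∀ r : ℕ, ((s * r : ℕ) : ZMod Q) = A ↔ (r : ZMod Q) = A' := by
      intro p
      rw [hA', Units.eq_inv_mul_iff_mul_eq, ← hu]
      push_cast
      rfl
    have hIe : I s = ∑ r ∈ (Icc 1 (T / s)).filter (fun r : ℕ => (r : ZMod Q) = A'), sqf a r := by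
      simp only [I, hiff, sum_filter]
      exact sum_congr rfl fun r _ => by simp only [mul_ite, mul_one, mul_zero]
    have hyY := hyT s hs.1 hsz
    set Y := T / s with hYdef
    have hY2 : 2 ≤ Y := by exact_mod_cast hy.trans hyY
    have hY0 : (0 : ℝ) < Y := by linarith
    have hYT : (Y : ℝ) ≤ (T : ℝ) / s := Nat.cast_div_le
    have hlogY : Real.log Y ≤ L :=
      Real.log_le_log hY0 (by exact_mod_cast Nat.div_le_self T s)
    have hlogyY : Real.log y ≤ Real.log Y := Real.log_le_log (by linarith) hyY
    have hlogY0 : 0 < Real.log Y := hlogy.trans_le hlogyY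
    rw [hIe]
    refine (sum_sqf_progression_le ha haH Q hQ hA'u Y hY2).trans ?_
    have b1 : √Y * (1 + Real.log Y) ^ H ≤ (T : ℝ) / s / Q * (1 / L) := by
      have : √Y * ((1 + Real.log Y) ^ H * (Q * L)) ≤ Y := by
        calc √Y * ((1 + Real.log Y) ^ H * (Q * L)) ≤ √Y * √Y := by
              refine mul_le_mul_of_nonneg_left ?_ (Real.sqrt_nonneg _)
              calc (1 + Real.log Y) ^ H * (Q * L) ≤ (1 + L) ^ H * (Q * L) := by gcongr
                _ ≤ √y := by linarith
                _ ≤ √Y := Real.sqrt_le_sqrt hyY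
          _ = Y := Real.mul_self_sqrt hY0.le
      rw [div_mul_div_comm, mul_one, le_div_iff₀ (by positivity)]
      calc _ = √Y * ((1 + Real.log Y) ^ H * (Q * L)) := by ring
        _ ≤ _ := this.trans hYT
    have b2 : Real.exp (-(Real.log Y / (4 * Real.log Q))) * Y * (1 + Real.log Y) ^ (3 * H) ≤
        (T : ℝ) / s / Q * (1 / L) := by
      rw [div_mul_div_comm, mul_one, le_div_iff₀ (by positivity)]
      calc _ = Real.exp (-(Real.log Y / (4 * Real.log Q))) * (1 + Real.log Y) ^ (3 * H) *
              (Q * L) * Y := by ring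
        _ ≤ Real.exp (-(Real.log y / (4 * Real.log Q))) * (1 + L) ^ (3 * H) * (Q * L) * Y := by
            gcongr
        _ ≤ 1 * Y := by gcongr
        _ ≤ _ := by rw [one_mul]; exact hYT
    have hXY : ∑ r ∈ Icc 1 Y with r.Coprime Q, sqf a r / r ≤ X := by
      refine le_trans ?_ (sum_sqf_div_le_exp ha T Q)
      refine sum_le_sum_of_subset_of_nonneg (filter_subset_filter _
        (Icc_subset_Icc_right (Nat.div_le_self T s))) fun r _ _ => div_nonneg (hG r) (by positivity)
    have hlog4 : Real.log 4 ≤ 2 * Real.log Q := by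
      have : (4 : ℝ) = 2 ^ 2 := by norm_num
      rw [this, Real.log_pow]
      have : Real.log 2 ≤ Real.log Q := Real.log_le_log (by norm_num) (by exact_mod_cast hQ)
      push_cast; linarith
    have hlog40 : 0 ≤ Real.log 4 := Real.log_nonneg (by norm_num)
    have hinv : 4 / Real.log Y ≤ 4 * κ / L := by
      rw [div_le_div_iff₀ hlogY0 hlogT]
      have : L ≤ κ * Real.log Y := h4.trans (by gcongr)
      linarith
    have hsum0 : 0 ≤ ∑ r ∈ Icc 1 Y with r.Coprime Q, sqf a r / r :=
      sum_nonneg fun r _ => div_nonneg (hG r) (by positivity)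
    have b3 : 4 / Real.log Y * H * (2 * Y / Q * (2 * Real.log Q + Real.log 4) *
        ∑ r ∈ Icc 1 Y with r.Coprime Q, sqf a r / r) ≤
        (T : ℝ) / s / Q * (32 * H * κ * Real.log Q * (X / L)) := by
      calc _ ≤ 4 * κ / L * H * (2 * ((T : ℝ) / s) / Q * (4 * Real.log Q) * X) := by
            gcongr; linarith
        _ = _ := by ring
    calc _ ≤ (T : ℝ) / s / Q * (1 / L) + (T : ℝ) / s / Q * (1 / L) +
          (T : ℝ) / s / Q * (32 * H * κ * Real.log Q * (X / L)) := add_le_add (add_le_add b1 b2) b3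
      _ = _ := by rw [hc]; ring
  have hpt : ∀ s ∈ Icc 1 T, powerful B s * I s ≤
      (if s = 1 then I 1 else 0) +
      (if s.Coprime Q ∧ s ≠ 1 then (T : ℝ) / Q * c * (powerful B s / s) else 0) +
      (if s.Coprime Q ∧ z < s then (T : ℝ) * (1 + L) ^ H * (powerful B s / s) else 0) := by
    intro s hs
    have hs1 := (mem_Icc.1 hs).1
    have n2 : 0 ≤ (T : ℝ) / Q * c * (powerful B s / s) :=
      mul_nonneg (by positivity) (div_nonneg (he s) (by positivity))
    have n3 : 0 ≤ (T : ℝ) * (1 + L) ^ H * (powerful B s / s) :=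
      mul_nonneg (by positivity) (div_nonneg (he s) (by positivity))
    by_cases hs1' : s = 1
    · subst hs1'
      rw [(isMultiplicative_powerful B).map_one, one_mul, if_pos rfl, if_neg (by simp),
        if_neg (by push_cast; exact fun h => absurd hz (not_le.2 h.2))]
      linarith
    rw [if_neg hs1', zero_add]
    by_cases hsQ : s.Coprime Q
    swap
    · rw [hInc s hsQ, if_neg (fun h => hsQ h.1), if_neg (fun h => hsQ h.1)]; simp
    rw [if_pos ⟨hsQ, hs1'⟩]
    by_cases hsz : z < s
    · rw [if_pos ⟨hsQ, hsz⟩]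
      have : powerful B s * I s ≤ (T : ℝ) * (1 + L) ^ H * (powerful B s / s) := by
        calc _ ≤ powerful B s * ((T : ℝ) / s * (1 + L) ^ H) :=
              mul_le_mul_of_nonneg_left (hIbig s hs) (he s)
          _ = _ := by ring
      linarith
    · rw [if_neg (fun h => hsz h.2), add_zero]
      calc _ ≤ powerful B s * ((T : ℝ) / s / Q * c) :=
              mul_le_mul_of_nonneg_left (hIsmall s hs hsQ (not_lt.1 hsz)) (he s)
          _ = _ := by ring
  have hsum1 : ∑ s ∈ Icc 1 T with s.Coprime Q ∧ s ≠ 1, powerful B s / s ≤ 8 * B ^ 2 / w := by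
    have hb := sum_powerful_div_le hB0 hw0 (by nlinarith) T Q hQw
    have hsplit : ∑ s ∈ Icc 1 T with s.Coprime Q, powerful B s / s =
        1 + ∑ s ∈ Icc 1 T with s.Coprime Q ∧ s ≠ 1, powerful B s / s := by
      rw [← sum_filter_add_sum_filter_not _ (fun s => s = 1), filter_filter, filter_filter]
      congr 1
      rw [sum_eq_single 1]
      · simp [(isMultiplicative_powerful B).map_one]
      · intro s hs hs1; exact absurd (mem_filter.1 hs).2.2 hs1
      · intro h; exfalso; apply h
        rw [mem_filter, mem_Icc]
        exact ⟨⟨le_rfl, by omega⟩, Nat.coprime_one_left Q, rfl⟩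
    -- Removing `s = 1` turns the Euler bound `exp x` into `exp x - 1 ≤ 2 x`, which is where the
    -- saving `1 / w` arises.
    have hx := exp_sub_one_le_two_mul (x := 4 * B ^ 2 / w) (by positivity)
      (by rw [div_le_one hw0]; nlinarith)
    have : 8 * B ^ 2 / w = 2 * (4 * B ^ 2 / w) := by ring
    linarith
  have hsum2 := sum_powerful_tail_le hB hw (zero_lt_one.trans_le hz) T Q hQw
  set Z := Real.exp (2 * B ^ 2 * ∑' n : ℕ, (n : ℝ) ^ (-(3 / 2) : ℝ)) with hZ
  have hZ0 : 0 < Z := Real.exp_pos _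
  have htot : ∑ s ∈ Icc 1 T, powerful B s * I s ≤ I 1 + (T : ℝ) / Q * c * (8 * B ^ 2 / w) +
      (T : ℝ) * (1 + L) ^ H * (z ^ (-(1 / 4) : ℝ) * Z) := by
    refine (sum_le_sum hpt).trans ?_
    rw [sum_add_distrib, sum_add_distrib, ← sum_filter, ← sum_filter, ← sum_filter, ← mul_sum,
      ← mul_sum]
    refine add_le_add (add_le_add ?_ ?_) ?_
    · rw [filter_eq', if_pos (mem_Icc.2 ⟨le_rfl, by omega⟩), sum_singleton]
    · exact mul_le_mul_of_nonneg_left hsum1 (by positivity)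
    · exact mul_le_mul_of_nonneg_left hsum2 (by positivity)
  have hB1 : 8 * B ^ 2 / w ≤ 2 := by rw [div_le_iff₀ hw0]; nlinarith
  rw [hsum, ← hI1]
  calc (Q : ℝ) / T * ∑ s ∈ Icc 1 T, powerful B s * I s
      ≤ (Q : ℝ) / T * (I 1 + (T : ℝ) / Q * c * (8 * B ^ 2 / w) +
      (T : ℝ) * (1 + L) ^ H * (z ^ (-(1 / 4) : ℝ) * Z)) :=
        mul_le_mul_of_nonneg_left htot (by positivity)
    _ = (Q : ℝ) / T * I 1 + c * (8 * B ^ 2 / w) +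
        (Q * (1 + L) ^ H * z ^ (-(1 / 4) : ℝ) * L) * (Z / L) := by
        have e1 : (Q : ℝ) / T * ((T : ℝ) / Q) = 1 := by
          rw [div_mul_div_cancel₀ hT0.ne', div_self hQ0.ne']
        have e2 : (Q : ℝ) / T * T = Q := div_mul_cancel₀ _ hT0.ne'
        have e3 : L * (Z / L) = Z := mul_div_cancel₀ _ hlogT.ne'
        generalize z ^ (-(1 / 4) : ℝ) = ζ
        generalize (1 + L) ^ H = P
        linear_combination c * (8 * B ^ 2 / w) * e1 + P * ζ * Z * e2 - Q * P * ζ * e3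
    _ ≤ (Q : ℝ) / T * I 1 + (4 / L + 256 * B ^ 2 * H * κ * (Real.log Q / w) * (X / L)) +
        1 * (Z / L) := by
        refine add_le_add (add_le_add le_rfl ?_) ?_
        · have e1 : c * (8 * B ^ 2 / w) = 2 / L * (8 * B ^ 2 / w) +
              256 * B ^ 2 * H * κ * (Real.log Q / w) * (X / L) := by rw [hc]; ring
          rw [e1]
          have : 2 / L * (8 * B ^ 2 / w) ≤ 2 / L * 2 := by gcongr
          have e2 : 2 / L * 2 = 4 / L := by ring
          linarith
        · exact mul_le_mul_of_nonneg_right h3 (by positivity)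
    _ = _ := by ring

open Filter

/-! ### The parameters for large `N` -/

theorem eventually_mul_pow_le_exp (c : ℝ) (k : ℕ) {b : ℝ} (hb : 0 < b) :
    ∀ᶠ x : ℝ in atTop, c * x ^ k ≤ Real.exp (b * x) := by
  have h := (isLittleO_pow_exp_pos_mul_atTop k hb).def (c := 1 / (|c| + 1)) (by positivity)
  filter_upwards [h, eventually_ge_atTop 0] with x hx hx0
  rw [Real.norm_of_nonneg (by positivity), Real.norm_of_nonneg (by positivity), one_div,
    inv_mul_eq_div, le_div_iff₀ (by positivity)] at hx
  have : c * x ^ k ≤ |c| * x ^ k := by gcongr; exact le_abs_self c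
  nlinarith [pow_nonneg hx0 k]

/-- `L` stands for `log N`, so that `log L` is the scale of `w N`. -/
theorem eventually_size_bounds (E H : ℕ) (b c₀ C₀ : ℝ) :
    ∀ᶠ L : ℝ in atTop, 2 * 3 ^ H ≤ L ∧ 2 ≤ L ∧
      2 * L ^ (4 * (E + H + 4)) ≤ Real.exp (1 / 4 * L) ∧
      2 * 3 ^ H * L ^ (E + 3 + H) ≤ Real.exp (1 / 8 * L) ∧
      c₀⁻¹ ≤ Real.exp (1 / 4 * L) ∧ C₀ ≤ Real.exp (1 * L) ∧
      16 * (E + 2) * (((3 * H + E + 3 : ℕ) : ℝ) * Real.log L + Real.log (2 * 3 ^ (3 * H))) *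
        Real.log L ≤ L ∧
      1 ≤ Real.log L ∧ 1 ≤ Real.log (Real.log L) ∧
      Real.log (Real.log L) ≤ √(Real.log L) ∧ (2 * b) ^ 2 ≤ √(Real.log L) ∧
      2 ≤ √(Real.log L) := by
  have hlog := Real.tendsto_log_atTop
  have hloglog := hlog.comp hlog
  have hsqrt := Real.tendsto_sqrt_atTop.comp hlog
  have e1 : ∀ᶠ x : ℝ in atTop,
      16 * (E + 2) * (((3 * H + E + 3 : ℕ) : ℝ) * x + Real.log (2 * 3 ^ (3 * H))) * x ≤
        Real.exp x := by
    filter_upwards [eventually_mul_pow_le_exp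
      (16 * (E + 2) * (((3 * H + E + 3 : ℕ) : ℝ) + Real.log (2 * 3 ^ (3 * H)))) 2 one_pos,
      eventually_ge_atTop 1] with x hx hx1
    rw [one_mul] at hx
    refine le_trans ?_ hx
    have h0 : 0 ≤ Real.log (2 * 3 ^ (3 * H)) := by
      refine Real.log_nonneg ?_
      have : (1 : ℝ) ≤ 3 ^ (3 * H) := one_le_pow₀ (by norm_num)
      linarith
    have h1 : Real.log (2 * 3 ^ (3 * H)) ≤ Real.log (2 * 3 ^ (3 * H)) * x :=
      le_mul_of_one_le_right h0 hx1
    calc _ ≤ 16 * ((E : ℝ) + 2) * (((3 * H + E + 3 : ℕ) : ℝ) * x +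
          Real.log (2 * 3 ^ (3 * H)) * x) * x := by gcongr
      _ = _ := by ring
  have e2 : ∀ᶠ x : ℝ in atTop, Real.log x ≤ √x := by
    filter_upwards [eventually_gt_atTop 0] with x hx
    -- With `u = x ^ (1/4)`: `log x = 4 log u ≤ 4 (u - 1) ≤ u²`.
    have h1 := Real.log_le_sub_one_of_pos (x := √(√x)) (by positivity)
    rw [Real.log_sqrt (by positivity), Real.log_sqrt hx.le] at h1
    have h2 : √(√x) ^ 2 = √x := Real.sq_sqrt (by positivity)
    nlinarith [sq_nonneg (√(√x) - 2)]
  filter_upwards [eventually_ge_atTop (2 * 3 ^ H), eventually_ge_atTop 2,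
    eventually_mul_pow_le_exp 2 (4 * (E + H + 4)) (show (0 : ℝ) < 1 / 4 by norm_num),
    eventually_mul_pow_le_exp (2 * 3 ^ H) (E + 3 + H) (show (0 : ℝ) < 1 / 8 by norm_num),
    eventually_mul_pow_le_exp c₀⁻¹ 0 (show (0 : ℝ) < 1 / 4 by norm_num),
    eventually_mul_pow_le_exp C₀ 0 one_pos, hlog.eventually e1, hlog.eventually_ge_atTop 1,
    hloglog.eventually_ge_atTop 1, hlog.eventually e2, hsqrt.eventually_ge_atTop ((2 * b) ^ 2),
    hsqrt.eventually_ge_atTop 2] with L h1 h2 h3 h4 h5 h6 h7 h8 h9 h10 h11 h12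
  rw [Real.exp_log (by linarith)] at h7
  rw [pow_zero, mul_one] at h5 h6
  exact ⟨h1, h2, h3, h4, h5, h6, h7, h8, h9, h10, h11, h12⟩

/-- For large `N` one has `N ^ (1/2) ≤ T ≤ N²` and `Q ≤ (log N) ^ (E + 2)`; the choice is `y = N ^
(1/4)` and `z` a power of `log N`. The last conclusion lets the factor `Q / φ(Q)` absorb `log Q /
w`, and there the lower bound on `w` is decisive. -/
theorem exists_modulus_bounds (E H : ℕ) (b : ℝ) (w : ℕ → ℝ) (hw : IsAdmissibleGrowth w) (ε : ℕ → ℝ)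
    (hε : Tendsto ε atTop (nhds 0)) (c₀ C₀ : ℝ) (hc₀ : 0 < c₀) :
    ∃ N₁ : ℕ, ∀ N T : ℕ, N₁ ≤ N → c₀ * (N : ℝ) ^ (1 - ε N) ≤ T → (T : ℝ) ≤ C₀ * N →
      ∀ q : ℕ, 1 ≤ q → (q : ℝ) ≤ Real.log N ^ E → ∀ Q : ℕ, Q = primeProd w N * q →
        2 ≤ Q ∧ 2 ≤ T ∧ (2 * b) ^ 2 ≤ w N ∧ (∀ p : ℕ, p.Prime → ¬ p ∣ Q → w N < p) ∧
        ∃ y z : ℝ, 1 ≤ z ∧ 2 ≤ y ∧ (∀ s : ℕ, 1 ≤ s → (s : ℝ) ≤ z → y ≤ (T / s : ℕ)) ∧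
          Q * Real.log T * (1 + Real.log T) ^ H ≤ √y ∧
          Real.exp (-(Real.log y / (4 * Real.log Q))) * (1 + Real.log T) ^ (3 * H) *
            (Q * Real.log T) ≤ 1 ∧
          Q * (1 + Real.log T) ^ H * z ^ (-(1 / 4) : ℝ) * Real.log T ≤ 1 ∧
          Real.log T ≤ 8 * Real.log y ∧
          Real.log Q / w N * Nat.totient Q ≤ 2 * (E + 2) * Q := by
  have hlogN : Tendsto (fun N : ℕ => Real.log N) atTop atTop :=
    Real.tendsto_log_atTop.comp tendsto_natCast_atTop_atTop
  have hev := (hlogN.eventually (eventually_size_bounds E H b c₀ C₀)).and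
    (hw.lower.and (hw.upper.and ((hε.eventually_le_const (show (0 : ℝ) < 1 / 4 by norm_num)).and
      (eventually_ge_atTop 1))))
  obtain ⟨N₁, hN₁⟩ := eventually_atTop.1 hev
  refine ⟨N₁, fun N T hN hT1 hT2 q hq1 hq2 Q hQ => ?_⟩
  obtain ⟨⟨a1, a2, a3, a4, a5, a6, a7, a8, a9, a10, a11, a12⟩, hwl, hwu, hεN, hN1⟩ := hN₁ N hN
  have hn1 : (1 : ℝ) ≤ N := by exact_mod_cast hN1
  have hn0 : (0 : ℝ) < N := by linarith
  set L := Real.log N with hL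
  set x := Real.log L with hx
  have hNL : (N : ℝ) = Real.exp L := (Real.exp_log hn0).symm
  have hL0 : 0 < L := by linarith
  have hLx : L = Real.exp x := (Real.exp_log hL0).symm
  -- size of `T`
  have hTlow : Real.exp (1 / 2 * L) ≤ T := by
    calc Real.exp (1 / 2 * L) = 1 * Real.exp (1 / 2 * L) := (one_mul _).symm
      _ ≤ (c₀ * Real.exp (1 / 4 * L)) * Real.exp (1 / 2 * L) := by
          gcongr
          rw [inv_le_iff_one_le_mul₀ hc₀] at a5
          linarith
      _ = c₀ * (N : ℝ) ^ (3 / 4 : ℝ) := by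
          rw [mul_assoc, ← Real.exp_add, Real.rpow_def_of_pos hn0]
          congr 2; ring
      _ ≤ c₀ * (N : ℝ) ^ (1 - ε N) := by
          refine mul_le_mul_of_nonneg_left ?_ hc₀.le
          exact Real.rpow_le_rpow_of_exponent_le hn1 (by linarith)
      _ ≤ T := hT1
  have hTup : (T : ℝ) ≤ Real.exp (2 * L) := by
    calc (T : ℝ) ≤ C₀ * N := hT2
      _ ≤ Real.exp (1 * L) * Real.exp L := by rw [hNL] ; gcongr
      _ = _ := by rw [← Real.exp_add]; congr 1; ring
  have hT0 : (0 : ℝ) < T := (Real.exp_pos _).trans_le hTlow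
  have hlogT : Real.log T ≤ 2 * L := by
    rw [← Real.log_exp (2 * L)]; exact Real.log_le_log hT0 hTup
  have hlogT' : 1 / 2 * L ≤ Real.log T := by
    rw [← Real.log_exp (1 / 2 * L)]; exact Real.log_le_log (Real.exp_pos _) hTlow
  have hlogT0 : 0 < Real.log T := by linarith
  have hT2 : 2 ≤ T := by
    by_contra h
    have : (T : ℝ) ≤ 1 := by exact_mod_cast (by omega : T ≤ 1)
    have := Real.log_nonpos hT0.le this
    linarith
  have hlogT3 : 1 + Real.log T ≤ 3 * L := by linarith
  -- size of `w N`
  have hw1 : √x < w N := by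
    refine lt_of_le_of_lt ?_ hwl
    rw [le_div_iff₀ (by linarith)]
    calc √x * Real.log x ≤ √x * √x := by gcongr
      _ = x := Real.mul_self_sqrt (by linarith)
  have hw0 : 0 < w N := by linarith
  have hlogw : Real.log x ≤ 2 * Real.log (w N) := by
    have := Real.log_le_log (by linarith) hw1.le
    rw [Real.log_sqrt (by linarith)] at this
    linarith
  -- size of the modulus
  have hWpos : 0 < primeProd w N := primorial_pos _
  have hWQ : primeProd w N ∣ Q := hQ ▸ dvd_mul_right _ _
  have hQpos : 0 < Q := by rw [hQ]; positivity
  have hdvd : ∀ p : ℕ, p.Prime → p ≤ ⌊w N⌋₊ → p ∣ Q := fun p hp h =>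
    ((Nat.Prime.dvd_primorial_iff hp).2 h).trans hWQ
  have hQ2 : 2 ≤ Q := Nat.le_of_dvd hQpos (hdvd 2 Nat.prime_two (Nat.le_floor (by
    push_cast; linarith)))
  have hQ0 : (0 : ℝ) < Q := by exact_mod_cast hQpos
  have hWle : (primeProd w N : ℝ) ≤ L ^ 2 := by
    have h1 : (primeProd w N : ℝ) ≤ 4 ^ ⌊w N⌋₊ := by exact_mod_cast primorial_le_four_pow _
    have h2 : Real.log 4 ≤ 2 := by
      have : (4 : ℝ) = 2 ^ 2 := by norm_num
      rw [this, Real.log_pow]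
      have := Real.log_two_lt_d9
      push_cast; linarith
    calc (primeProd w N : ℝ) ≤ 4 ^ ⌊w N⌋₊ := h1
      _ = Real.exp (⌊w N⌋₊ * Real.log 4) := by
          rw [mul_comm, ← Real.rpow_natCast, Real.rpow_def_of_pos (by norm_num)]
      _ ≤ Real.exp (x * 2) := by
          apply Real.exp_le_exp.2
          have := Nat.floor_le hw0.le
          have h4 : 0 ≤ Real.log 4 := Real.log_nonneg (by norm_num)
          calc (⌊w N⌋₊ : ℝ) * Real.log 4 ≤ x * Real.log 4 := by gcongr; linarith
            _ ≤ x * 2 := by gcongr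
      _ = L ^ 2 := by rw [hLx, ← Real.exp_nat_mul]; congr 1; push_cast; ring
  have hQle : (Q : ℝ) ≤ L ^ (E + 2) := by
    rw [hQ]; push_cast
    calc (primeProd w N : ℝ) * q ≤ L ^ 2 * L ^ E := by gcongr
      _ = _ := by rw [← pow_add, add_comm]
  have hlogQ : Real.log Q ≤ (E + 2) * x := by
    have := Real.log_le_log hQ0 hQle
    rw [Real.log_pow] at this
    push_cast at this
    exact this
  have hlogQ0 : 0 < Real.log Q := Real.log_pos (by exact_mod_cast hQ2)
  refine ⟨hQ2, hT2, by linarith, fun p hp hpQ => ?_, Real.exp (1 / 4 * L), L ^ (4 * (E + H + 4)),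
    one_le_pow₀ (by linarith), ?_, fun s hs1 hs2 => ?_, ?_, ?_, ?_, ?_, ?_⟩
  · by_contra h
    exact hpQ (hdvd p hp (Nat.le_floor (not_lt.1 h)))
  · have : (1 : ℝ) ≤ L ^ (4 * (E + H + 4)) := one_le_pow₀ (by linarith)
    linarith
  · have hs0 : (0 : ℝ) < s := by exact_mod_cast hs1
    have h1 : (T : ℝ) / s < (T / s : ℕ) + 1 := by
      rw [← Nat.floor_div_eq_div (K := ℝ)]
      exact Nat.lt_floor_add_one _
    -- The factor 2 pays for the loss of less than 1 in the integer quotient `T / s`, as `y ≥ 1`.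
    have h2 : 2 * Real.exp (1 / 4 * L) ≤ (T : ℝ) / s := by
      rw [le_div_iff₀ hs0]
      calc 2 * Real.exp (1 / 4 * L) * s ≤ 2 * Real.exp (1 / 4 * L) * L ^ (4 * (E + H + 4)) := by
            gcongr
        _ = Real.exp (1 / 4 * L) * (2 * L ^ (4 * (E + H + 4))) := by ring
        _ ≤ Real.exp (1 / 4 * L) * Real.exp (1 / 4 * L) := by gcongr
        _ = Real.exp (1 / 2 * L) := by rw [← Real.exp_add]; congr 1; ring
        _ ≤ T := hTlow
    have h3 : 1 ≤ Real.exp (1 / 4 * L) := Real.one_le_exp (by positivity)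
    linarith
  · have : √(Real.exp (1 / 4 * L)) = Real.exp (1 / 8 * L) := by
      rw [← Real.exp_half]; congr 1; ring
    rw [this]
    refine le_trans ?_ a4
    calc Q * Real.log T * (1 + Real.log T) ^ H ≤ L ^ (E + 2) * (2 * L) * (3 * L) ^ H := by gcongr
      _ = _ := by rw [mul_pow]; ring
  · rw [Real.log_exp]
    have h1 : ((3 * H + E + 3 : ℕ) : ℝ) * x + Real.log (2 * 3 ^ (3 * H)) ≤
        1 / 4 * L / (4 * Real.log Q) := by
      have hc : 0 ≤ ((3 * H + E + 3 : ℕ) : ℝ) * x + Real.log (2 * 3 ^ (3 * H)) := by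
        refine add_nonneg (by positivity) (Real.log_nonneg ?_)
        have : (1 : ℝ) ≤ 3 ^ (3 * H) := one_le_pow₀ (by norm_num)
        linarith
      rw [le_div_iff₀ (by positivity)]
      calc _ ≤ (((3 * H + E + 3 : ℕ) : ℝ) * x + Real.log (2 * 3 ^ (3 * H))) *
            (4 * ((E + 2) * x)) := by gcongr
        _ ≤ _ := by linarith
    have h2 : (1 + Real.log T) ^ (3 * H) * (Q * Real.log T) ≤
        Real.exp (1 / 4 * L / (4 * Real.log Q)) := by
      calc _ ≤ (3 * L) ^ (3 * H) * (L ^ (E + 2) * (2 * L)) := by gcongr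
        _ = L ^ (3 * H + E + 3) * (2 * 3 ^ (3 * H)) := by rw [mul_pow]; ring
        _ = Real.exp (((3 * H + E + 3 : ℕ) : ℝ) * x + Real.log (2 * 3 ^ (3 * H))) := by
            rw [Real.exp_add, Real.exp_log (by positivity), Real.exp_nat_mul, ← hLx]
        _ ≤ _ := Real.exp_le_exp.2 h1
    rw [Real.exp_neg, mul_assoc, inv_mul_le_iff₀ (Real.exp_pos _), mul_one]
    exact h2
  -- The exponent of `z` is chosen to beat `Q (log T) ^ (H + 1)`, of order `L ^ (E + H + 3)`, with
  -- one power of `L` left for the constant `2 * 3 ^ H`.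
  · have hz : (L ^ (4 * (E + H + 4))) ^ (-(1 / 4) : ℝ) = (L ^ (E + H + 4))⁻¹ := by
      rw [Real.rpow_neg (by positivity), mul_comm 4, pow_mul, ← Real.rpow_natCast _ 4,
        ← Real.rpow_mul (by positivity)]
      norm_num
    rw [hz]
    calc Q * (1 + Real.log T) ^ H * (L ^ (E + H + 4))⁻¹ * Real.log T
        ≤ L ^ (E + 2) * (3 * L) ^ H * (L ^ (E + H + 4))⁻¹ * (2 * L) := by gcongr
      _ = 2 * 3 ^ H / L := by
          rw [mul_pow]; field_simp; ring
      _ ≤ 1 := by rw [div_le_one hL0]; exact a1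
  · rw [Real.log_exp]; linarith
  · have h1 := totient_mul_log_le ⌊w N⌋₊ Q hQpos.ne' hdvd
    have h2 : Real.log (w N) ≤ Real.log (⌊w N⌋₊ + 1) :=
      Real.log_le_log hw0 (Nat.lt_floor_add_one _).le
    have hφ : (0 : ℝ) ≤ Nat.totient Q := by positivity
    have h3 : x ≤ w N * Real.log x := by
      rw [div_lt_iff₀ (by linarith)] at hwl
      exact hwl.le
    have h4 : Real.log Q / w N ≤ 2 * (E + 2) * Real.log (⌊w N⌋₊ + 1) := by
      rw [div_le_iff₀ hw0]
      calc Real.log Q ≤ (E + 2) * x := hlogQ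
        _ ≤ (E + 2) * (w N * (2 * Real.log (⌊w N⌋₊ + 1))) := by
            gcongr
            refine h3.trans ?_
            gcongr
            linarith
        _ = _ := by ring
    calc _ ≤ 2 * (E + 2) * Real.log (⌊w N⌋₊ + 1) * Nat.totient Q := by gcongr
      _ = 2 * (E + 2) * (Nat.totient Q * Real.log (⌊w N⌋₊ + 1)) := by ring
      _ ≤ _ := by gcongr

/-! ### The decomposition -/

/-- The factors of the decomposition `f = f_1 * ⋯ * f_H`: all but the last are supported on
squarefree integers, with value `f p / H` at each prime `p`. -/
noncomputable def decomp (f : ArithmeticFunction ℝ) (H : ℕ) (i : Fin H) : ArithmeticFunction ℝ :=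
  if (i : ℕ) + 1 < H then sqf fun p => f p / H else f * geo (fun p => f p / H) ^ (H - 1)

section decomp

variable {f : ArithmeticFunction ℝ} {H : ℕ}

theorem isMultiplicative_decomp (hf : f.IsMultiplicative) (i : Fin H) :
    (decomp f H i).IsMultiplicative := by
  unfold decomp
  split_ifs
  · exact isMultiplicative_sqf _
  · exact hf.mul (isMultiplicative_geo _).pow

/-- The last factor carries one inverse `geo` for each of the other `H - 1` factors. -/
theorem prod_decomp (f : ArithmeticFunction ℝ) (hH : 1 ≤ H) : ∏ i, decomp f H i = f := by
  obtain ⟨n, rfl⟩ : ∃ n, H = n + 1 := ⟨H - 1, by omega⟩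
  rw [Fin.prod_univ_castSucc]
  have h1 : ∀ i : Fin n, decomp f (n + 1) i.castSucc = sqf fun p => f p / (n + 1 : ℕ) := fun i =>
    if_pos (by simp)
  have h2 : decomp f (n + 1) (Fin.last n) = f * geo (fun p => f p / (n + 1 : ℕ)) ^ n :=
    if_neg (by simp)
  simp_rw [h1]
  rw [h2, prod_const, card_univ, Fintype.card_fin, mul_left_comm, ← mul_pow, sqf_mul_geo, one_pow,
    mul_one]

theorem decomp_prime (hf : f.IsMultiplicative) (hH : 1 ≤ H) (i : Fin H) {p : ℕ} (hp : p.Prime) :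
    decomp f H i p = f p / H := by
  unfold decomp
  split_ifs
  · exact sqf_prime _ hp
  · have hg := isMultiplicative_geo fun p => f p / H
    rw [conv_prime _ _ hf.map_one hg.pow.map_one hp, ← card_range (H - 1), ← prod_const,
      prod_conv_prime _ _ (fun _ _ => hg) hp]
    have := geo_prime_pow (fun p => f p / H) hp 1
    rw [pow_one, pow_one] at this
    rw [this, sum_const, card_range, nsmul_eq_mul, Nat.cast_sub hH]
    have : (H : ℝ) ≠ 0 := by positivity
    field_simp
    push_cast
    ring

theorem decomp_squarefree (i : Fin H) (hi : (i : ℕ) + 1 < H) (n : ℕ) (hn : decomp f H i n ≠ 0) :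
    Squarefree n := by
  rw [decomp, if_pos hi] at hn
  exact squarefree_of_sqf_ne_zero hn

/-- Growth rates add under convolution: `H` from `f` and 1 from each of the `H - 1` copies of `geo`.
-/
theorem abs_decomp_prime_pow_le (hf : f.IsMultiplicative) (hH : 1 ≤ H)
    (hfH : ∀ p k : ℕ, p.Prime → 1 ≤ k → |f (p ^ k)| ≤ (H : ℝ) ^ k) (i : Fin H) {p : ℕ}
    (hp : p.Prime) (k : ℕ) : |decomp f H i (p ^ k)| ≤ (2 * H : ℝ) ^ k := by
  have hH1 : (1 : ℝ) ≤ H := by exact_mod_cast hH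
  have hfp : |f p / H| ≤ 1 := by
    rw [abs_div, abs_of_nonneg (by linarith : (0 : ℝ) ≤ H), div_le_one (by linarith)]
    simpa using hfH p 1 hp le_rfl
  rcases eq_or_ne k 0 with rfl | hk
  · simp [(isMultiplicative_decomp hf i).map_one]
  unfold decomp
  split_ifs
  · rw [sqf_prime_pow _ hp hk]
    have h1 : (1 : ℝ) ≤ (2 * H) ^ k := one_le_pow₀ (by linarith)
    split_ifs
    · exact hfp.trans h1
    · rw [abs_zero]; linarith
  · rw [← card_range (H - 1), ← prod_const]
    have hgeo : ∀ k, |(∏ _i ∈ range (H - 1), geo fun p => f p / H) (p ^ k)| ≤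
        (∑ _i ∈ range (H - 1), (1 : ℝ)) ^ k :=
      abs_prod_conv_prime_pow_le _ _ (fun _ => 1) hp (fun _ _ => zero_le_one) fun _ _ k => by
        rw [geo_prime_pow _ hp, abs_pow, abs_neg]
        exact pow_le_pow_left₀ (abs_nonneg _) hfp k
    have hfk : ∀ k, |f (p ^ k)| ≤ (H : ℝ) ^ k := fun k => by
      rcases Nat.eq_zero_or_pos k with rfl | h
      · simp [hf.map_one]
      · exact hfH p k hp h
    refine (abs_conv_prime_pow_le hp (by linarith) hfk hgeo k).trans ?_
    refine pow_le_pow_left₀ (by positivity) ?_ k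
    rw [sum_const, card_range, nsmul_eq_mul, Nat.cast_sub hH]
    push_cast
    linarith

end decomp

/-- The pointwise absolute value. -/
noncomputable def absFun (u : ArithmeticFunction ℝ) : ArithmeticFunction ℝ :=
  ⟨fun n => |u n|, by simp⟩

theorem absFun_apply (u : ArithmeticFunction ℝ) (n : ℕ) : absFun u n = |u n| := rfl

theorem isMultiplicative_absFun {u : ArithmeticFunction ℝ} (hu : u.IsMultiplicative) :
    (absFun u).IsMultiplicative :=
  ⟨by simp [absFun_apply, hu.map_one], fun {m n} h => by
    simp [absFun_apply, hu.map_mul_of_coprime h, abs_mul]⟩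

theorem sqf_abs_le {f : ArithmeticFunction ℝ} (hf : f.IsMultiplicative) (n : ℕ) :
    sqf (fun p => |f p|) n ≤ |f n| :=
  IsMultiplicative.le_of_prime_pow (isMultiplicative_sqf _) (isMultiplicative_absFun hf)
    (sqf_nonneg fun _ => abs_nonneg _) (fun p k hp hk => by
      rw [sqf_prime_pow _ hp hk, absFun_apply]
      split_ifs with h
      · rw [h, pow_one]
      · exact abs_nonneg _) n

/-! ### Cauchy–Schwarz -/

/-- The factor `D` in the second moment splits the weight `c(d) / D` evenly: the summand is `√(c(d)
/ D)` times `√(c(d) (Q / T) J(D))`. After Cauchy–Schwarz both sums over tuples become sums of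
convolutions. -/
theorem sum_cofactorTuples_le_sqrt_mul_sqrt {t : ℕ} (F : Fin t → ArithmeticFunction ℝ) (i : Fin t)
    {T W Q : ℕ} (hT : 1 ≤ T) {A : ZMod Q} (hA : IsUnit A) :
    ∑ d ∈ cofactorTuples i T W, (∏ j : {j : Fin t // j ≠ i}, |F j (d j)| / (d j : ℝ)) *
        Real.sqrt (progSecondMoment (F i) T (∏ j, d j) Q A) ≤
      √(∑ D ∈ Icc 1 T with D.Coprime Q, (∏ j : {j : Fin t // j ≠ i}, absFun (F j)) D / D) *
      √((Q : ℝ) / T * ∑ m ∈ (Icc 1 T).filter (fun m : ℕ => (m : ZMod Q) = A),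
        ((F i).pmul (F i) * ∏ j : {j : Fin t // j ≠ i}, absFun (F j)) m) := by
  set h' : ArithmeticFunction ℝ := ∏ j : {j : Fin t // j ≠ i}, absFun (F j) with hh'
  set u : ArithmeticFunction ℝ := (F i).pmul (F i) with hu
  have hT0 : (0 : ℝ) < T := by exact_mod_cast hT
  have habs0 : ∀ (j : {j : Fin t // j ≠ i}) (n : ℕ), 0 ≤ absFun (F j) n := fun j n => abs_nonneg _
  have hbox : ∀ d ∈ cofactorTuples i T W, (∀ j, d j ∈ Icc 1 T) ∧ ∏ j, d j ≤ T := by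
    intro d hd
    rw [cofactorTuples, mem_filter, Fintype.mem_piFinset] at hd
    refine ⟨hd.1, ?_⟩
    have h1 : (T : ℝ) ^ (1 - 1 / (t : ℝ)) ≤ T := by
      conv_rhs => rw [← Real.rpow_one (T : ℝ)]
      refine Real.rpow_le_rpow_of_exponent_le (by exact_mod_cast hT) ?_
      have : 0 ≤ 1 / (t : ℝ) := by positivity
      linarith
    exact_mod_cast hd.2.2.trans h1
  have hDpos : ∀ d ∈ cofactorTuples i T W, 0 < ∏ j, d j := fun d hd => prod_pos fun j _ => by
    have := (hbox d hd).1 j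
    rw [mem_Icc] at this; omega
  let J : ℕ → ℝ := fun D => ∑ n ∈ Icc 1 (T / D), u n * if ((D * n : ℕ) : ZMod Q) = A then 1 else 0
  have hu0 : ∀ n, 0 ≤ u n := fun n => by rw [hu, pmul_apply]; exact mul_self_nonneg _
  have hJ0 : ∀ D, 0 ≤ J D := fun D => sum_nonneg fun n _ =>
    mul_nonneg (hu0 n) (by split_ifs <;> norm_num)
  have hmom : ∀ D, progSecondMoment (F i) T D Q A = (Q : ℝ) / T * (D * J D) := by
    intro D
    have : ∑ n ∈ Icc 1 (T / D) with ((n * D : ℕ) : ZMod Q) = A, |F i n| ^ 2 = J D := by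
      simp only [J, sum_filter]
      refine sum_congr rfl fun n _ => ?_
      rw [mul_comm n D, hu, pmul_apply, sq_abs, sq, mul_ite, mul_one, mul_zero]
    rw [progSecondMoment, this]
    ring
  -- As `A` is a unit, only `D` coprime to the whole modulus contribute, so this condition may be
  -- inserted in the first factor.
  have hJnc : ∀ D : ℕ, ¬ D.Coprime Q → J D = 0 := by
    intro D hD
    refine sum_eq_zero fun n _ => ?_
    rw [if_neg, mul_zero]
    intro h
    have : IsUnit ((D * n : ℕ) : ZMod Q) := h ▸ hA
    rw [ZMod.isUnit_iff_coprime] at this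
    exact hD (Nat.Coprime.coprime_mul_right this)
  let c : ({j : Fin t // j ≠ i} → ℕ) → ℝ := fun d => ∏ j : {j : Fin t // j ≠ i}, absFun (F j) (d j)
  have hc0 : ∀ d, 0 ≤ c d := fun d => prod_nonneg fun j _ => habs0 j _
  have hterm : ∀ d ∈ cofactorTuples i T W,
      (∏ j : {j : Fin t // j ≠ i}, |F j (d j)| / (d j : ℝ)) *
        √(progSecondMoment (F i) T (∏ j, d j) Q A) =
      √(c d * if (∏ j, d j).Coprime Q then ((∏ j, d j : ℕ) : ℝ)⁻¹ else 0) *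
        √(c d * ((Q : ℝ) / T * J (∏ j, d j))) := by
    intro d hd
    have hD0 : (0 : ℝ) < (∏ j, d j : ℕ) := by exact_mod_cast hDpos d hd
    have hcd : (∏ j : {j : Fin t // j ≠ i}, |F j (d j)| / (d j : ℝ)) =
        c d * ((∏ j, d j : ℕ) : ℝ)⁻¹ := by
      rw [prod_div_distrib, div_eq_mul_inv]
      push_cast
      rfl
    rw [hcd, hmom]
    split_ifs with hcop
    · rw [← Real.sqrt_mul (mul_nonneg (hc0 d) (inv_nonneg.2 hD0.le))]
      have e : (c d * ((∏ j, d j : ℕ) : ℝ)⁻¹) * (c d * ((Q : ℝ) / T * J (∏ j, d j))) =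
          (c d * ((∏ j, d j : ℕ) : ℝ)⁻¹) ^ 2 *
            ((Q : ℝ) / T * ((∏ j, d j : ℕ) * J (∏ j, d j))) := by
        field_simp
      rw [e, Real.sqrt_mul (sq_nonneg _),
        Real.sqrt_sq (mul_nonneg (hc0 d) (inv_nonneg.2 hD0.le))]
    · rw [hJnc _ hcop]; simp
  rw [sum_congr rfl hterm]
  have hψ0 : ∀ n : ℕ, 0 ≤ (if n.Coprime Q then (n : ℝ)⁻¹ else 0) := fun n => by
    split_ifs <;> positivity
  refine (Real.sum_sqrt_mul_sqrt_le _ (fun d => mul_nonneg (hc0 d) (hψ0 _))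
    (fun d => mul_nonneg (hc0 d) (mul_nonneg (by positivity) (hJ0 _)))).trans ?_
  refine mul_le_mul (Real.sqrt_le_sqrt ?_) (Real.sqrt_le_sqrt ?_) (Real.sqrt_nonneg _)
    (Real.sqrt_nonneg _)
  · refine (sum_piFinset_le_sum_prod (fun j : {j : Fin t // j ≠ i} => absFun (F j)) habs0
      (fun n => if n.Coprime Q then (n : ℝ)⁻¹ else 0) hψ0 T _ hbox).trans (le_of_eq ?_)
    rw [sum_filter]
    exact sum_congr rfl fun n _ => by split_ifs <;> simp [hh', div_eq_mul_inv]
  · refine (sum_piFinset_le_sum_prod (fun j : {j : Fin t // j ≠ i} => absFun (F j)) habs0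
      (fun n => (Q : ℝ) / T * J n) (fun n => mul_nonneg (by positivity) (hJ0 n)) T _ hbox).trans
      (le_of_eq ?_)
    have := sum_conv_mul h' u (fun m => if (m : ZMod Q) = A then 1 else 0) T
    rw [mul_comm u h', sum_filter]
    simp only [mul_ite, mul_one, mul_zero] at this
    rw [this, mul_sum]
    refine sum_congr rfl fun D _ => ?_
    rw [← hh', mul_left_comm, mul_sum]
    congr 1
    refine sum_congr rfl fun n _ => ?_
    simp only [mul_ite, mul_one, mul_zero]

/-! ### Majorants for the functions arising from the decomposition -/

section bounds

variable {f : ArithmeticFunction ℝ} {H : ℕ} (hf : f.IsMultiplicative) (hH : 1 ≤ H)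
  (hfH : ∀ p k : ℕ, p.Prime → 1 ≤ k → |f (p ^ k)| ≤ (H : ℝ) ^ k) (i : Fin H)

theorem sum_subtype_ne_const (i : Fin H) (x : ℝ) :
    ∑ _j : {j : Fin H // j ≠ i}, x = (H - 1) * x := by
  have hH : 1 ≤ H := by have := i.2; omega
  rw [sum_const, nsmul_eq_mul, card_univ, Fintype.card_subtype_compl, Fintype.card_fin,
    Fintype.card_subtype_eq, Nat.cast_sub hH, Nat.cast_one]

include hf hH in
theorem prod_absFun_decomp_prime {p : ℕ} (hp : p.Prime) :
    (∏ j : {j : Fin H // j ≠ i}, absFun (decomp f H j)) p = (H - 1) * (|f p| / H) := by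
  rw [prod_conv_prime _ _ (fun j _ => isMultiplicative_absFun (isMultiplicative_decomp hf _)) hp,
    ← sum_subtype_ne_const i]
  refine sum_congr rfl fun j _ => ?_
  rw [absFun_apply, decomp_prime hf hH _ hp, abs_div, Nat.abs_cast]

include hf hH hfH in
theorem abs_prod_absFun_decomp_prime_pow_le {p : ℕ} (hp : p.Prime) (k : ℕ) :
    |(∏ j : {j : Fin H // j ≠ i}, absFun (decomp f H j)) (p ^ k)| ≤ ((H - 1) * (2 * H) : ℝ) ^ k := by
  rw [← sum_subtype_ne_const i]
  refine abs_prod_conv_prime_pow_le _ _ _ hp (fun _ _ => by positivity) (fun j _ k => ?_) k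
  rw [absFun_apply, abs_abs]
  exact abs_decomp_prime_pow_le hf hH hfH _ hp k

include hf hH hfH in
theorem prod_absFun_decomp_le (n : ℕ) :
    (∏ j : {j : Fin H // j ≠ i}, absFun (decomp f H j)) n ≤
      (sqf (fun p => |f p|) * powerful (6 * (H : ℝ) ^ 2)) n := by
  have hH1 : (1 : ℝ) ≤ H := by exact_mod_cast hH
  refine le_sqf_mul_powerful
    (isMultiplicative_finsetProd _ _ fun j _ => isMultiplicative_absFun (isMultiplicative_decomp hf _))
    (prod_conv_nonneg _ _ fun _ _ => abs_nonneg _) (fun _ => abs_nonneg _) (by positivity)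
    (fun p hp => ?_) (fun p k hp => ?_) n
  · rw [prod_absFun_decomp_prime hf hH i hp, mul_div_assoc', div_le_iff₀ (by linarith)]
    nlinarith [abs_nonneg (f p)]
  · refine (le_abs_self _).trans
      ((abs_prod_absFun_decomp_prime_pow_le hf hH hfH i hp k).trans ?_)
    have : 0 ≤ (H : ℝ) - 1 := by linarith
    exact pow_le_pow_left₀ (by positivity) (by nlinarith) k

-- With `v = |f p| / H ≤ 1`, the value at a prime is `v² + (H - 1) v ≤ H v = |f p|`. At higher
-- powers, `(2H)² + (H - 1)(2H) ≤ 6H²`.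
include hf hH hfH in
theorem sq_decomp_mul_prod_le (n : ℕ) :
    ((decomp f H i).pmul (decomp f H i) *
        ∏ j : {j : Fin H // j ≠ i}, absFun (decomp f H j)) n ≤
      (sqf (fun p => |f p|) * powerful (6 * (H : ℝ) ^ 2)) n := by
  have hH1 : (1 : ℝ) ≤ H := by exact_mod_cast hH
  have hFi := isMultiplicative_decomp hf i
  have hu := hFi.pmul hFi
  have hh' : (∏ j : {j : Fin H // j ≠ i}, absFun (decomp f H j)).IsMultiplicative :=
    isMultiplicative_finsetProd _ _ fun j _ => isMultiplicative_absFun (isMultiplicative_decomp hf _)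
  refine le_sqf_mul_powerful (hu.mul hh')
    (conv_nonneg (fun n => by rw [pmul_apply]; exact mul_self_nonneg _)
      (prod_conv_nonneg _ _ fun _ _ => abs_nonneg _)) (fun _ => abs_nonneg _) (by positivity)
    (fun p hp => ?_) (fun p k hp => ?_) n
  · rw [conv_prime _ _ hu.map_one hh'.map_one hp, prod_absFun_decomp_prime hf hH i hp, pmul_apply,
      decomp_prime hf hH i hp]
    have hfp : |f p| ≤ H := by simpa using hfH p 1 hp le_rfl
    have h1 : f p / H * (f p / H) = |f p| / H * (|f p| / H) := by
      rw [div_mul_div_comm, div_mul_div_comm, abs_mul_abs_self]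
    have h2 : |f p| / H ≤ 1 := (div_le_one (by linarith)).2 hfp
    have h3 : 0 ≤ |f p| / H := by positivity
    have h4 : |f p| = H * (|f p| / H) := by field_simp
    rw [h1]
    nlinarith
  · refine (le_abs_self _).trans ((abs_conv_prime_pow_le (A := (2 * (H : ℝ)) ^ 2) hp (by positivity)
      (fun k => ?_) (abs_prod_absFun_decomp_prime_pow_le hf hH hfH i hp) k).trans ?_)
    · have := abs_decomp_prime_pow_le hf hH hfH i hp k
      rw [pmul_apply, abs_mul, ← sq, ← pow_mul, mul_comm 2 k, pow_mul]
      exact pow_le_pow_left₀ (abs_nonneg _) this 2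
    · have : 0 ≤ (H : ℝ) - 1 := by linarith
      exact pow_le_pow_left₀ (by positivity) (by nlinarith) k

end bounds

theorem sum_prod_conv_div_le {a : ℕ → ℝ} (ha : ∀ p, 0 ≤ a p) {B w : ℝ} (hB : 1 ≤ B)
    (hw : (2 * B) ^ 2 ≤ w) {T Q : ℕ} (hQw : ∀ p : ℕ, p.Prime → ¬ p ∣ Q → w < p)
    {u : ArithmeticFunction ℝ} (hu : ∀ n, u n ≤ (sqf a * powerful B) n) :
    ∑ D ∈ Icc 1 T with D.Coprime Q, u D / D ≤
      Real.exp 1 * Real.exp (∑ p ∈ Icc 1 T with p.Prime ∧ ¬ p ∣ Q, a p / p) := by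
  have hB0 : 0 ≤ B := by linarith
  have hw0 : 0 < w := lt_of_lt_of_le (by positivity) hw
  calc ∑ D ∈ Icc 1 T with D.Coprime Q, u D / D
      ≤ ∑ D ∈ Icc 1 T with D.Coprime Q, (sqf a * powerful B) D / D :=
        sum_le_sum fun D _ => div_le_div_of_nonneg_right (hu D) (by positivity)
    _ ≤ _ := sum_conv_div_le (sqf_nonneg ha) (powerful_nonneg hB0) (fun n => n.Coprime Q)
        (fun a b h => ⟨Nat.Coprime.coprime_mul_right h, Nat.Coprime.coprime_mul_left h⟩) T
    _ ≤ Real.exp (∑ p ∈ Icc 1 T with p.Prime ∧ ¬ p ∣ Q, a p / p) * Real.exp 1 := by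
        refine mul_le_mul (sum_sqf_div_le_exp ha T Q) ?_ (sum_nonneg fun n _ =>
          div_nonneg (powerful_nonneg hB0 n) (by positivity)) (Real.exp_pos _).le
        refine (sum_powerful_div_le hB0 hw0 (by nlinarith) T Q hQw).trans (Real.exp_le_exp.2 ?_)
        rw [div_le_one hw0]
        nlinarith
    _ = _ := mul_comm _ _

end MultDecomp

/-! ### Proof of the main theorem -/

open MultDecomp in
theorem lemma3p1 (E H : ℕ) (hE : 1 ≤ E) (hH : 1 ≤ H)
    (w : ℕ → ℝ) (hw : IsAdmissibleGrowth w)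
    -- the rate `o(1)` and the implied constants in `N ^ (1 - o(1)) ≪ T ≪ N`
    (ε : ℕ → ℝ) (hε : Filter.Tendsto ε Filter.atTop (nhds 0))
    (c₀ C₀ : ℝ) (hc₀ : 0 < c₀) (hC₀ : 0 < C₀)
    -- the implied constants of the two hypotheses on `f`
    (c₁ c₂ C₂ : ℝ) (hc₁ : 0 < c₁) (hc₂ : 0 < c₂) (hC₂ : 0 < C₂) :
    ∃ K : ℝ, ∃ N₁ : ℕ, ∀ f : ArithmeticFunction ℝ, f.IsMultiplicative →
      (∀ p k : ℕ, p.Prime → 1 ≤ k → |f (p ^ k)| ≤ (H : ℝ) ^ k) →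
      ∃ F : Fin H → ArithmeticFunction ℝ,
        (∀ i, (F i).IsMultiplicative) ∧
        ∏ i, F i = f ∧
        (∀ i, ∀ p : ℕ, p.Prime → F i p = f p / H) ∧
        (∀ i : Fin H, (i : ℕ) + 1 < H → ∀ n : ℕ, F i n ≠ 0 → Squarefree n) ∧
        ∀ N T : ℕ, N₁ ≤ N →
          c₀ * (N : ℝ) ^ (1 - ε N) ≤ T → (T : ℝ) ≤ C₀ * N →
          (∀ q : ℕ, 1 ≤ q → (q : ℝ) ≤ Real.log N ^ E →
            ∀ A : (ZMod (primeProd w N * q))ˣ,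
              0 < progMean (fun n => |f n|) T (primeProd w N * q) A →
              c₁ * ((T : ℝ) / (Nat.totient (primeProd w N * q) : ℝ)) ≤
                  primeLogSum f T (primeProd w N * q) A ∧
                c₂ * shiuOrder f T (primeProd w N * q) ≤
                  progMean (fun n => |f n|) T (primeProd w N * q) A ∧
                progMean (fun n => |f n|) T (primeProd w N * q) A ≤
                  C₂ * shiuOrder f T (primeProd w N * q)) →
          ∀ q : ℕ, 1 ≤ q → (q : ℝ) ≤ Real.log N ^ E →
            ∀ A : (ZMod (primeProd w N * q))ˣ,
              0 < progMean (fun n => |f n|) T (primeProd w N * q) A →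
              avgSecondMoment F T (primeProd w N) q A ≤
                K * Real.log T ^ (1 - 1 / 2 : ℝ) *
                  progMean (fun n => |f n|) T (primeProd w N * q) A := by
  have hH1 : (1 : ℝ) ≤ H := by exact_mod_cast hH
  set B : ℝ := 6 * (H : ℝ) ^ 2 with hBdef
  have hB : 1 ≤ B := by rw [hBdef]; nlinarith
  obtain ⟨N₁, hN₁⟩ := exists_modulus_bounds E H B w hw ε hε c₀ C₀ hc₀
  set Z := Real.exp (2 * B ^ 2 * ∑' n : ℕ, (n : ℝ) ^ (-(3 / 2) : ℝ)) with hZ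
  -- The three terms of `sum_progression_mul_powerful_le` in units of `S`; the 8 is `κ`, from `log T
  -- ≤ 8 log y`.
  set K₁ : ℝ := 1 + (4 + Z) / c₂ + 256 * B ^ 2 * H * 8 * (2 * (E + 2)) / c₂ with hK₁
  have hZ0 : 0 < Z := Real.exp_pos _
  have hK₁0 : 0 ≤ K₁ := by positivity
  refine ⟨H * √(Real.exp 1 / c₂ * K₁), N₁, fun f hf hfH => ⟨decomp f H,
    isMultiplicative_decomp hf, prod_decomp f hH, fun i p hp => decomp_prime hf hH i hp,
    decomp_squarefree, fun N T hN hT1 hT2 hyp q hq1 hq2 A hA => ?_⟩⟩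
  obtain ⟨hQ2, hT2', hwB, hQw, y, z, hz, hy, hyT, e1, e2, e3, e4, e5⟩ :=
    hN₁ N T hN hT1 hT2 q hq1 hq2 _ rfl
  have hS := (hyp q hq1 hq2 A hA).2.1
  rw [avgSecondMoment]
  clear hyp
  generalize primeProd w N * q = Q at *
  set S := progMean (fun n => |f n|) T Q A with hSdef
  have ha : ∀ p, 0 ≤ |f p| := fun p => abs_nonneg _
  have haH : ∀ p : ℕ, p.Prime → |f p| ≤ H := fun p hp => by simpa using hfH p 1 hp le_rfl
  have hlogT : 0 < Real.log T := Real.log_pos (by exact_mod_cast hT2')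
  have hw0 : 0 < w N := lt_of_lt_of_le (by positivity) hwB
  have hφ : (0 : ℝ) < Nat.totient Q := by
    exact_mod_cast Nat.totient_pos.2 (by omega)
  have hφQ : (Nat.totient Q : ℝ) ≤ Q := by exact_mod_cast Nat.totient_le Q
  set X := Real.exp (∑ p ∈ Finset.Icc 1 T with p.Prime ∧ ¬ p ∣ Q, |f p| / p) with hX
  have hX1 : 1 ≤ X := Real.one_le_exp (Finset.sum_nonneg fun p _ => by positivity)
  have hshiu : (Q : ℝ) / Nat.totient Q * (X / Real.log T) ≤ S / c₂ := by
    rw [le_div_iff₀ hc₂]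
    calc _ = c₂ * shiuOrder f T Q := by rw [shiuOrder, ← hX]; ring
      _ ≤ S := hS
  have hXS : X / Real.log T ≤ S / c₂ := by
    refine le_trans (le_mul_of_one_le_left (by positivity) ?_) hshiu
    rwa [one_le_div hφ]
  have h1S : 1 / Real.log T ≤ S / c₂ := le_trans (by gcongr) hXS
  have hQS : Real.log Q / w N * (X / Real.log T) ≤ 2 * (E + 2) * (S / c₂) := by
    calc Real.log Q / w N * (X / Real.log T)
        ≤ 2 * (E + 2) * ((Q : ℝ) / Nat.totient Q) * (X / Real.log T) := by
          refine mul_le_mul_of_nonneg_right ?_ (by positivity)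
          rwa [mul_div_assoc', le_div_iff₀ hφ]
      _ = 2 * (E + 2) * ((Q : ℝ) / Nat.totient Q * (X / Real.log T)) := by ring
      _ ≤ _ := by gcongr
  have hcore := sum_progression_mul_powerful_le ha haH hQ2 A.isUnit hT2' hB hwB hz hQw hy hyT
    e1 e2 e3 e4
  rw [← hZ, ← hX] at hcore
  have hGS : (Q : ℝ) / T * ∑ m ∈ (Finset.Icc 1 T).filter (fun m : ℕ => (m : ZMod Q) = A),
      sqf (fun p => |f p|) m ≤ S := by
    rw [hSdef, progMean]
    exact mul_le_mul_of_nonneg_left (Finset.sum_le_sum fun m _ => sqf_abs_le hf m) (by positivity)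
  have hM : (Q : ℝ) / T * ∑ m ∈ (Finset.Icc 1 T).filter (fun m : ℕ => (m : ZMod Q) = A),
      (sqf (fun p => |f p|) * powerful B) m ≤ K₁ * S := by
    refine hcore.trans ?_
    have t2 : (4 + Z) / Real.log T ≤ (4 + Z) * (S / c₂) := by
      rw [div_eq_mul_one_div]; gcongr
    have t3 : 256 * B ^ 2 * H * 8 * (Real.log Q / w N) * (X / Real.log T) ≤
        256 * B ^ 2 * H * 8 * (2 * (E + 2) * (S / c₂)) := by
      rw [mul_assoc]; gcongr
    calc _ ≤ S + (4 + Z) * (S / c₂) + 256 * B ^ 2 * H * 8 * (2 * (E + 2) * (S / c₂)) :=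
          add_le_add (add_le_add hGS t2) t3
      _ = K₁ * S := by rw [hK₁]; ring
  have hterm : ∀ i : Fin H, ∑ d ∈ cofactorTuples i T (primeProd w N),
      (∏ j : {j : Fin H // j ≠ i}, |decomp f H j (d j)| / (d j : ℝ)) *
        Real.sqrt (progSecondMoment (decomp f H i) T (∏ j, d j) Q A) ≤
      √(Real.exp 1 / c₂ * K₁) * (√(Real.log T) * S) := by
    intro i
    refine (sum_cofactorTuples_le_sqrt_mul_sqrt (decomp f H) i (by omega) A.isUnit).trans ?_
    have b1 := sum_prod_conv_div_le (T := T) ha hB hwB hQw (prod_absFun_decomp_le hf hH hfH i)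
    rw [← hX] at b1
    -- The factor `log T` enters only here, under one of the two square roots, hence `θ_f = 1/2`.
    have b1' : Real.exp 1 * X ≤ Real.exp 1 / c₂ * (Real.log T * S) := by
      rw [div_le_iff₀ hlogT] at hXS
      calc Real.exp 1 * X ≤ Real.exp 1 * (S / c₂ * Real.log T) := by gcongr
        _ = _ := by ring
    have b2 : (Q : ℝ) / T * ∑ m ∈ (Finset.Icc 1 T).filter (fun m : ℕ => (m : ZMod Q) = A),
        ((decomp f H i).pmul (decomp f H i) *
          ∏ j : {j : Fin H // j ≠ i}, absFun (decomp f H j)) m ≤ K₁ * S :=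
      le_trans (mul_le_mul_of_nonneg_left (Finset.sum_le_sum fun m _ =>
        sq_decomp_mul_prod_le hf hH hfH i m) (by positivity)) hM
    calc _ ≤ √(Real.exp 1 / c₂ * (Real.log T * S)) * √(K₁ * S) :=
          mul_le_mul (Real.sqrt_le_sqrt (b1.trans b1')) (Real.sqrt_le_sqrt b2)
            (Real.sqrt_nonneg _) (Real.sqrt_nonneg _)
      _ = √(Real.exp 1 / c₂ * K₁ * Real.log T * S ^ 2) := by
          rw [← Real.sqrt_mul (by positivity)]; congr 1; ring
      _ = _ := by
          rw [Real.sqrt_mul (by positivity), Real.sqrt_sq hA.le, Real.sqrt_mul (by positivity),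
            mul_assoc]
  have hpow : Real.log T ^ (1 - 1 / 2 : ℝ) = √(Real.log T) := by
    rw [Real.sqrt_eq_rpow]; norm_num
  rw [hpow]
  refine (Finset.sum_le_sum fun i _ => hterm i).trans (le_of_eq ?_)
  rw [Finset.sum_const, Finset.card_univ, Fintype.card_fin, nsmul_eq_mul]
  ring
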